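/- **Setting.** Let $R$ be an associative unital ring (not necessarily commutative) and $n\ge 0$. *Quasi-determinants.* For a matrix $A=(a_{ij})$ over $R$ and finite index sets $I\ni i$, $K\ni j$ with $|I|=|K|$, the quasi-determinant $|A^I_K|_{ij}$ of the submatrix $A^I_K$ with rows $I$ and columns $K$ is well defined if $B:=A^{I\setminus\{i\}}_{K\setminus\{j\}}$ is invertible, and then $$|A^I_K|_{ij}=a_{ij}-\sum_{k\in K\setminus\{j\},\;l\in I\setminus\{i\}}a_{ik}\,(B^{-1})_{kl}\,a_{lj}.$$ The left and right quasi-Plücker coordinates are $$q^{J}_{ij}(A^I)=\bigl(|A^I_{\{i\}\cup J}|_{si}\bigr)^{-1}|A^I_{\{j\}\cup J}|_{sj}\ (i\notin J),\qquad r^{J}_{ij}(A_K)=|A^{\{i\}\cup J}_K|_{it}\bigl(|A^{\{j\}\cup J}_K|_{jt}\bigr)^{-1}\ (j\notin J),$$ for any $s\in I$ (resp. $t\in K$) for which the two quasi-determinants are well defined and the inverted one is invertible; the value does not depend on this choice, and the coordinate is called well defined if such a choice exists. *L-operators.* Consider pairs $\mathbf L^{(a)}=(\mathbf L^{+(a)},\mathbf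 L^{-(a)})$, $a=1,2$, of $n\times n$ matrices over $R$ with $\mathbf L^{+(a)}$ upper triangular, $\mathbf L^{-(a)}$ lower triangular, $\mathbf L^{+(a)}_{ii}=\mathbf u^{(a)}_i$, $\mathbf L^{-(a)}_{ii}=\mathbf u^{(a)}_{i-1}$, $\mathbf u^{(a)}_0=1$ and all $\mathbf u^{(a)}_i$ invertible; likewise $\widetilde{\mathbf L}^{(a)}$ with $\widetilde{\mathbf u}^{(a)}_i$. The zero-curvature relation is $$\mathbf L^{+(1)}\mathbf L^{+(2)}=\widetilde{\mathbf L}^{+(2)}\widetilde{\mathbf L}^{+(1)},\quad \mathbf L^{-(1)}\mathbf L^{+(2)}=\widetilde{\mathbf L}^{+(2)}\widetilde{\mathbf L}^{-(1)},\quad \mathbf L^{-(1)}\mathbf L^{-(2)}=\widetilde{\mathbf L}^{-(2)}\widetilde{\mathbf L}^{-(1)}.\tag{ZC}$$ Put $\mathbf J=\mathbf L^{-(1)}\mathbf L^{+(2)}$, $\widetilde{\mathbf J}=\widetilde{\mathbf L}^{+(2)}\widetilde{\mathbf L}^{-(1)}$ and $$\mathbf M=\begin{pmatrix}0&\mathbf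 L^{-(1)}\mathbf L^{-(2)}\\ \mathbf L^{+(1)}\mathbf L^{+(2)}&\mathbf J\end{pmatrix},\qquad \widetilde{\mathbf M}=\begin{pmatrix}0&\widetilde{\mathbf L}^{+(2)}\widetilde{\mathbf L}^{+(1)}\\ \widetilde{\mathbf L}^{-(2)}\widetilde{\mathbf L}^{-(1)}&\widetilde{\mathbf J}\end{pmatrix},$$ with rows and columns indexed by $\bar1,\dots,\bar n,1,\dots,n$. Write $\overrightarrow{\prod}_{k=1}^{m}x_k=x_1\cdots x_m$ and $\overleftarrow{\prod}_{k=1}^{m}x_k=x_m\cdots x_1$. Abbreviate $q_{k;ab}=q^{k+1,\dots,n}_{ab}(\mathbf M^{k,\dots,n})$, $r_{k;ab}=r^{k+1,\dots,n}_{ab}(\mathbf M_{k,\dots,n})$, $\widetilde q_{k;ab}=q^{1,\dots,k-1}_{ab}(\widetilde{\mathbf M}^{1,\dots,k})$, $\widetilde r_{k;ab}=r^{1,\dots,k-1}_{ab}(\widetilde{\mathbf M}_{1,\dots,k})$, where the left coordinates use all columns, and the right coordinates all rows, of the block matrix. *Forward map* $F:(\mathbf L^{(1)},\mathbf L^{(2)})\mapsto(\widetilde{\mathbf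 L}^{(1)},\widetilde{\mathbf L}^{(2)})$: for $1\le i\le j\le n$ (entries outside the triangles are $0$) $$\widetilde{\mathbf L}^{+(1)}_{ij}=\Bigl(\overrightarrow{\prod_{k=1}^{i-1}}q_{k;k\bar k}\Bigr)q_{i;i\bar j},\quad \widetilde{\mathbf L}^{-(1)}_{ji}=\Bigl(\overrightarrow{\prod_{k=1}^{j-1}}q_{k;k\bar k}\Bigr)q_{j;ji},\quad \widetilde{\mathbf L}^{+(2)}_{ij}=r_{j;i\bar j}\overleftarrow{\prod_{k=1}^{j-1}}r_{k;k\bar k},\quad \widetilde{\mathbf L}^{-(2)}_{ji}=r_{i;\bar j\bar i}\overleftarrow{\prod_{k=1}^{i-1}}r_{k;k\bar k}.$$ Its domain $D$ consists of the $(\mathbf L^{(1)},\mathbf L^{(2)})$ as above such that all $|\mathbf J^{k,\dots,n}_{k,\dots,n}|_{kk}$, $1\le k\le n$, are well defined and invertible. *Backward map* $G:(\widetilde{\mathbf L}^{(1)},\widetilde{\mathbf L}^{(2)})\mapsto(\mathbf L^{(1)},\mathbf L^{(2)})$: for $1\le i\le j\le n$ (entries outside the triangles are $0$) $$\mathbf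 L^{+(1)}_{ij}=\widetilde r_{j;\bar i j}\overleftarrow{\prod_{k=1}^{j-1}}\widetilde r_{k;\bar k k},\quad \mathbf L^{-(1)}_{ji}=\widetilde r_{i;ji}\overleftarrow{\prod_{k=1}^{i-1}}\widetilde r_{k;\bar k k},\quad \mathbf L^{+(2)}_{ij}=\Bigl(\overrightarrow{\prod_{k=1}^{i-1}}\widetilde q_{k;\bar k k}\Bigr)\widetilde q_{i;\bar i j},\quad \mathbf L^{-(2)}_{ji}=\Bigl(\overrightarrow{\prod_{k=1}^{j-1}}\widetilde q_{k;\bar k k}\Bigr)\widetilde q_{j;\bar j\bar i}.$$ Its domain $\widetilde D$ consists of the $(\widetilde{\mathbf L}^{(1)},\widetilde{\mathbf L}^{(2)})$ as above such that all $|\widetilde{\mathbf J}^{1,\dots,k}_{1,\dots,k}|_{kk}$, $1\le k\le n$, are well defined and invertible. **Theorem.** All quasi-Plücker coordinates in the formulas for $F$ on $D$ and for $G$ on $\widetilde D$ are well defined. The map $G$ sends $\widetilde D$ into $D$, the map $F$ sends $D$ into $\widetilde D$, and $G$ is the inverse map of $F$: $F(G(Y))=Y$ for all $Y\in\widetilde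 D$ and $G(F(X))=X$ for all $X\in D$. Moreover the zero-curvature relation (ZC) holds between $G(Y)$ and $Y$ for every $Y\in\widetilde D$, and between $X$ and $F(X)$ for every $X\in D$. -/

import Mathlib

open scoped Classical in
/-- `X` restricts to a two-sided inverse of the submatrix of `A` with rows `I` and columns `K`
(entries of `X` outside `K × I` play no role). -/
def IsBlockInv {R ι κ : Type*} [Ring R] (A : Matrix ι κ R) (I : Finset ι) (K : Finset κ)
    (X : Matrix κ ι R) : Prop :=
  (∀ l ∈ I, ∀ l' ∈ I, ∑ k ∈ K, A l k * X k l' = if l = l' then 1 else 0) ∧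
  (∀ k ∈ K, ∀ k' ∈ K, ∑ l ∈ I, X k l * A l k' = if k = k' then 1 else 0)

open scoped Classical in
/-- The inverse of the submatrix of `A` with rows `I` and columns `K`; zero if there is none. -/
noncomputable def blockInv {R ι κ : Type*} [Ring R] (A : Matrix ι κ R) (I : Finset ι)
    (K : Finset κ) : Matrix κ ι R :=
  if h : ∃ X, IsBlockInv A I K X then h.choose else 0

/-- The quasi-determinant `|A^I_K|_{ij}` of the square submatrix with rows `I ∋ i` and columns
`K ∋ j` is well defined: deleting row `i` and column `j` leaves an invertible matrix. -/
def QuasidetDefined {R ι κ : Type*} [Ring R] [DecidableEq ι] [DecidableEq κ]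
    (A : Matrix ι κ R) (I : Finset ι) (K : Finset κ) (i : ι) (j : κ) : Prop :=
  i ∈ I ∧ j ∈ K ∧ I.card = K.card ∧ ∃ X, IsBlockInv A (I.erase i) (K.erase j) X

/-- The quasi-determinant `|A^I_K|_{ij} = a_{ij} - ∑_{k ≠ j, l ≠ i} a_{ik} ((A^{ij})⁻¹)_{kl} a_{lj}`
of the submatrix of `A` with rows `I` and columns `K`. -/
noncomputable def quasidet {R ι κ : Type*} [Ring R] [DecidableEq ι] [DecidableEq κ]
    (A : Matrix ι κ R) (I : Finset ι) (K : Finset κ) (i : ι) (j : κ) : R :=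
  A i j - ∑ k ∈ K.erase j, ∑ l ∈ I.erase i,
    A i k * blockInv A (I.erase i) (K.erase j) k l * A l j

/-- The row `s` can be used to compute the left quasi-Plücker coordinate `q^J_{ij}(A^I)`. -/
def LeftQPAdmissible {R ι κ : Type*} [Ring R] [DecidableEq ι] [DecidableEq κ]
    (A : Matrix ι κ R) (I : Finset ι) (J : Finset κ) (i j : κ) (s : ι) : Prop :=
  i ∉ J ∧ QuasidetDefined A I (insert i J) s i ∧ QuasidetDefined A I (insert j J) s j ∧
    IsUnit (quasidet A I (insert i J) s i)

/-- The column `t` can be used to compute the right quasi-Plücker coordinate `r^J_{ij}(A_K)`. -/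
def RightQPAdmissible {R ι κ : Type*} [Ring R] [DecidableEq ι] [DecidableEq κ]
    (A : Matrix ι κ R) (K : Finset κ) (J : Finset ι) (i j : ι) (t : κ) : Prop :=
  j ∉ J ∧ QuasidetDefined A (insert i J) K i t ∧ QuasidetDefined A (insert j J) K j t ∧
    IsUnit (quasidet A (insert j J) K j t)

/-- The left quasi-Plücker coordinate `q^J_{ij}(A^I)` is well defined. -/
def LeftQPDefined {R ι κ : Type*} [Ring R] [DecidableEq ι] [DecidableEq κ]
    (A : Matrix ι κ R) (I : Finset ι) (J : Finset κ) (i j : κ) : Prop :=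
  ∃ s, LeftQPAdmissible A I J i j s

/-- The right quasi-Plücker coordinate `r^J_{ij}(A_K)` is well defined. -/
def RightQPDefined {R ι κ : Type*} [Ring R] [DecidableEq ι] [DecidableEq κ]
    (A : Matrix ι κ R) (K : Finset κ) (J : Finset ι) (i j : ι) : Prop :=
  ∃ t, RightQPAdmissible A K J i j t

open scoped Classical in
/-- The left quasi-Plücker coordinate
`q^J_{ij}(A^I) = (|A^I_{i,J}|_{si})⁻¹ |A^I_{j,J}|_{sj}` of the matrix formed by the rows `I` of `A`,
for any admissible `s` (see `leftQP_eq` for the independence of `s`). -/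
noncomputable def leftQP {R ι κ : Type*} [Ring R] [DecidableEq ι] [DecidableEq κ]
    (A : Matrix ι κ R) (I : Finset ι) (J : Finset κ) (i j : κ) : R :=
  if h : LeftQPDefined A I J i j then
    Ring.inverse (quasidet A I (insert i J) h.choose i) * quasidet A I (insert j J) h.choose j
  else 0

open scoped Classical in
/-- The right quasi-Plücker coordinate
`r^J_{ij}(A_K) = |A^{i,J}_K|_{it} (|A^{j,J}_K|_{jt})⁻¹` of the matrix formed by the columns `K` of
`A`, for any admissible `t` (see `rightQP_eq` for the independence of `t`). -/
noncomputable def rightQP {R ι κ : Type*} [Ring R] [DecidableEq ι] [DecidableEq κ]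
    (A : Matrix ι κ R) (K : Finset κ) (J : Finset ι) (i j : ι) : R :=
  if h : RightQPDefined A K J i j then
    quasidet A (insert i J) K i h.choose * Ring.inverse (quasidet A (insert j J) K j h.choose)
  else 0

theorem blockInv_spec {R ι κ : Type*} [Ring R] {A : Matrix ι κ R} {I : Finset ι}
    {K : Finset κ} (h : ∃ X, IsBlockInv A I K X) : IsBlockInv A I K (blockInv A I K) := by
  unfold blockInv
  rw [dif_pos h]
  exact h.choose_spec

/-- A row vector annihilating the columns `J` is determined by its entry at `s`, and its value on a
further column is that entry times a quasi-determinant. -/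
theorem left_aux {R ι κ : Type*} [Ring R] [DecidableEq ι] [DecidableEq κ]
    (A : Matrix ι κ R) (I : Finset ι) (J : Finset κ) (j : κ) (s : ι) (hj : j ∉ J)
    (hs : s ∈ I) (h : ∃ X, IsBlockInv A (I.erase s) J X) (v : ι → R)
    (hv : ∀ k ∈ J, ∑ l ∈ I, v l * A l k = 0) :
    ∑ l ∈ I, v l * A l j = v s * quasidet A I (insert j J) s j := by
  have hX := blockInv_spec h
  unfold quasidet
  rw [Finset.erase_insert hj]
  set X := blockInv A (I.erase s) J with hXdef
  have key : ∀ l ∈ I.erase s, v l = - ∑ k ∈ J, v s * A s k * X k l := by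
    intro l hl
    have h1 : ∑ k ∈ J, (∑ l' ∈ I, v l' * A l' k) * X k l = 0 :=
      Finset.sum_eq_zero fun k hk => by rw [hv k hk, zero_mul]
    have h2 : ∑ k ∈ J, (∑ l' ∈ I.erase s, v l' * A l' k) * X k l = v l := by
      simp_rw [Finset.sum_mul]
      rw [Finset.sum_comm]
      have : ∀ l' ∈ I.erase s, ∑ k ∈ J, v l' * A l' k * X k l = if l' = l then v l' else 0 := by
        intro l' hl'
        have := hX.1 l' hl' l hl
        simp_rw [mul_assoc, ← Finset.mul_sum, this]
        split_ifs <;> simp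
      rw [Finset.sum_congr rfl this, Finset.sum_ite_eq' (I.erase s) l v, if_pos hl]
    simp_rw [← Finset.add_sum_erase I _ hs, add_mul, Finset.sum_add_distrib] at h1
    rw [h2] at h1
    exact eq_neg_of_add_eq_zero_right h1
  rw [← Finset.add_sum_erase I _ hs,
    Finset.sum_congr rfl fun l hl => by rw [key l hl], mul_sub, sub_eq_add_neg]
  congr 1
  simp_rw [neg_mul, Finset.sum_neg_distrib, Finset.mul_sum, Finset.sum_mul]
  rw [Finset.sum_comm]
  simp_rw [mul_assoc]

theorem right_aux {R ι κ : Type*} [Ring R] [DecidableEq ι] [DecidableEq κ]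
    (A : Matrix ι κ R) (K : Finset κ) (J : Finset ι) (j : ι) (t : κ) (hj : j ∉ J)
    (ht : t ∈ K) (h : ∃ X, IsBlockInv A J (K.erase t) X) (v : κ → R)
    (hv : ∀ l ∈ J, ∑ k ∈ K, A l k * v k = 0) :
    ∑ k ∈ K, A j k * v k = quasidet A (insert j J) K j t * v t := by
  have hX := blockInv_spec h
  unfold quasidet
  rw [Finset.erase_insert hj]
  set X := blockInv A J (K.erase t) with hXdef
  have key : ∀ k ∈ K.erase t, v k = - ∑ l ∈ J, X k l * (A l t * v t) := by
    intro k hk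
    have h1 : ∑ l ∈ J, X k l * (∑ k' ∈ K, A l k' * v k') = 0 :=
      Finset.sum_eq_zero fun l hl => by rw [hv l hl, mul_zero]
    have h2 : ∑ l ∈ J, X k l * (∑ k' ∈ K.erase t, A l k' * v k') = v k := by
      simp_rw [Finset.mul_sum]
      rw [Finset.sum_comm]
      have : ∀ k' ∈ K.erase t, ∑ l ∈ J, X k l * (A l k' * v k') = if k = k' then v k' else 0 := by
        intro k' hk'
        have := hX.2 k hk k' hk'
        simp_rw [← mul_assoc, ← Finset.sum_mul, this]
        split_ifs <;> simp
      rw [Finset.sum_congr rfl this, Finset.sum_ite_eq (K.erase t) k v, if_pos hk]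
    simp_rw [← Finset.add_sum_erase K _ ht, mul_add, Finset.sum_add_distrib] at h1
    rw [h2] at h1
    exact eq_neg_of_add_eq_zero_right h1
  rw [← Finset.add_sum_erase K _ ht,
    Finset.sum_congr rfl fun k hk => by rw [key k hk], sub_mul, sub_eq_add_neg]
  congr 1
  simp_rw [mul_neg, Finset.sum_neg_distrib, Finset.mul_sum, Finset.sum_mul, mul_assoc]

theorem exists_left_row {R ι κ : Type*} [Ring R] [DecidableEq ι] [DecidableEq κ]
    (A : Matrix ι κ R) (I : Finset ι) (J : Finset κ) (s : ι)
    (hs : s ∈ I) (h : ∃ X, IsBlockInv A (I.erase s) J X) :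
    ∃ v : ι → R, v s = 1 ∧ ∀ k ∈ J, ∑ l ∈ I, v l * A l k = 0 := by
  obtain ⟨X, hX⟩ := h
  refine ⟨fun l => if l = s then 1 else - ∑ k ∈ J, A s k * X k l, by simp, fun k hk => ?_⟩
  rw [← Finset.add_sum_erase I _ hs]
  have : ∀ l ∈ I.erase s, (if l = s then (1 : R) else - ∑ k ∈ J, A s k * X k l) * A l k
      = - ∑ k' ∈ J, A s k' * (X k' l * A l k) := by
    intro l hl
    rw [if_neg (Finset.ne_of_mem_erase hl), neg_mul, Finset.sum_mul]
    simp_rw [mul_assoc]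
  rw [Finset.sum_congr rfl this, Finset.sum_neg_distrib, Finset.sum_comm]
  have : ∀ k' ∈ J, ∑ l ∈ I.erase s, A s k' * (X k' l * A l k) = if k' = k then A s k' else 0 := by
    intro k' hk'
    rw [← Finset.mul_sum, hX.2 k' hk' k hk]
    split_ifs <;> simp
  rw [Finset.sum_congr rfl this, Finset.sum_ite_eq' J k, if_pos hk]
  simp

theorem exists_right_col {R ι κ : Type*} [Ring R] [DecidableEq ι] [DecidableEq κ]
    (A : Matrix ι κ R) (K : Finset κ) (J : Finset ι) (t : κ)
    (ht : t ∈ K) (h : ∃ X, IsBlockInv A J (K.erase t) X) :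
    ∃ v : κ → R, v t = 1 ∧ ∀ l ∈ J, ∑ k ∈ K, A l k * v k = 0 := by
  obtain ⟨X, hX⟩ := h
  refine ⟨fun k => if k = t then 1 else - ∑ l ∈ J, X k l * A l t, by simp, fun l hl => ?_⟩
  rw [← Finset.add_sum_erase K _ ht]
  have : ∀ k ∈ K.erase t, A l k * (if k = t then (1 : R) else - ∑ l ∈ J, X k l * A l t)
      = - ∑ l' ∈ J, A l k * X k l' * A l' t := by
    intro k hk
    rw [if_neg (Finset.ne_of_mem_erase hk), mul_neg, Finset.mul_sum]
    simp_rw [mul_assoc]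
  rw [Finset.sum_congr rfl this, Finset.sum_neg_distrib, Finset.sum_comm]
  have : ∀ l' ∈ J, ∑ k ∈ K.erase t, A l k * X k l' * A l' t = if l = l' then A l' t else 0 := by
    intro l' hl'
    rw [← Finset.sum_mul, hX.1 l hl l' hl']
    split_ifs <;> simp
  rw [Finset.sum_congr rfl this, Finset.sum_ite_eq J l, if_pos hl]
  simp

/-- A left quasi-Plücker coordinate does not depend on the row used to compute it. -/
theorem leftQP_eq {R ι κ : Type*} [Ring R] [DecidableEq ι] [DecidableEq κ]
    {A : Matrix ι κ R} {I : Finset ι} {J : Finset κ} {i j : κ} {s : ι}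
    (h : LeftQPAdmissible A I J i j s) :
    leftQP A I J i j =
      Ring.inverse (quasidet A I (insert i J) s i) * quasidet A I (insert j J) s j := by
  have hd : LeftQPDefined A I J i j := ⟨s, h⟩
  unfold leftQP
  rw [dif_pos hd]
  have h' := hd.choose_spec
  set s' := hd.choose
  obtain ⟨hi, ⟨hs, -, hc1, hX⟩, ⟨-, -, hc2, -⟩, hu⟩ := h
  obtain ⟨-, ⟨hs', -, -, hX'⟩, -, hu'⟩ := h'
  have hj : j ∉ J := by
    intro hj
    rw [Finset.insert_eq_of_mem hj] at hc2
    rw [Finset.card_insert_of_notMem hi] at hc1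
    omega
  rw [Finset.erase_insert hi] at hX hX'
  obtain ⟨v, hv1, hv⟩ := exists_left_row A I J s hs hX
  have a1 := left_aux A I J i s hi hs hX v hv
  have a2 := left_aux A I J j s hj hs hX v hv
  have b1 := left_aux A I J i s' hi hs' hX' v hv
  have b2 := left_aux A I J j s' hj hs' hX' v hv
  rw [hv1, one_mul] at a1 a2
  rw [← a2, ← a1, b1, b2]
  have hu2 : IsUnit (v s' * quasidet A I (insert i J) s' i) := by rw [← b1, a1]; exact hu
  generalize quasidet A I (insert j J) s' j = y
  obtain ⟨d, hd'⟩ := hu'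
  rw [← hd'] at hu2 ⊢
  obtain ⟨w, hw⟩ := hu2
  have hvs : v s' = ((w * d⁻¹ : Rˣ) : R) := by rw [Units.val_mul, hw]; simp
  rw [hvs, ← Units.val_mul, Ring.inverse_unit, Ring.inverse_unit, ← mul_assoc, ← Units.val_mul]
  simp

/-- A right quasi-Plücker coordinate does not depend on the column used to compute it. -/
theorem rightQP_eq {R ι κ : Type*} [Ring R] [DecidableEq ι] [DecidableEq κ]
    {A : Matrix ι κ R} {K : Finset κ} {J : Finset ι} {i j : ι} {t : κ}
    (h : RightQPAdmissible A K J i j t) :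
    rightQP A K J i j =
      quasidet A (insert i J) K i t * Ring.inverse (quasidet A (insert j J) K j t) := by
  have hd : RightQPDefined A K J i j := ⟨t, h⟩
  unfold rightQP
  rw [dif_pos hd]
  have h' := hd.choose_spec
  set t' := hd.choose
  obtain ⟨hj, ⟨-, -, hc2, -⟩, ⟨-, ht, hc1, hX⟩, hu⟩ := h
  obtain ⟨-, -, ⟨-, ht', -, hX'⟩, hu'⟩ := h'
  have hi : i ∉ J := by
    intro hi
    rw [Finset.insert_eq_of_mem hi] at hc2
    rw [Finset.card_insert_of_notMem hj] at hc1
    omega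
  rw [Finset.erase_insert hj] at hX hX'
  obtain ⟨v, hv1, hv⟩ := exists_right_col A K J t ht hX
  have a1 := right_aux A K J i t hi ht hX v hv
  have a2 := right_aux A K J j t hj ht hX v hv
  have b1 := right_aux A K J i t' hi ht' hX' v hv
  have b2 := right_aux A K J j t' hj ht' hX' v hv
  rw [hv1, mul_one] at a1 a2
  rw [← a2, ← a1, b1, b2]
  have hu2 : IsUnit (quasidet A (insert j J) K j t' * v t') := by rw [← b2, a2]; exact hu
  generalize quasidet A (insert i J) K i t' = y
  obtain ⟨d, hd'⟩ := hu'
  rw [← hd'] at hu2 ⊢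
  obtain ⟨w, hw⟩ := hu2
  have hvs : v t' = ((d⁻¹ * w : Rˣ) : R) := by rw [Units.val_mul, hw]; simp
  rw [hvs, ← Units.val_mul, Ring.inverse_unit, Ring.inverse_unit, mul_assoc, ← Units.val_mul]
  simp

/-- A pair of `n × n` matrices `L⁺`, `L⁻` over `R`. The index `k : Fin n` stands for `k + 1`. -/
@[ext]
structure LPair (n : ℕ) (R : Type*) where
  plus : Matrix (Fin n) (Fin n) R
  minus : Matrix (Fin n) (Fin n) R

/-- `L⁺` is upper triangular with diagonal `u_1, …, u_n`, and `L⁻` is lower triangular with diagonal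
`u_0, …, u_{n-1}`, where `u_0 = 1` and all `u_k` are invertible. -/
def LPair.IsLOperator {n : ℕ} {R : Type*} [Ring R] (L : LPair n R) : Prop :=
  (∀ i j, j < i → L.plus i j = 0) ∧ (∀ i j, i < j → L.minus i j = 0) ∧
  ∃ u : ℕ → R, u 0 = 1 ∧ (∀ k, IsUnit (u k)) ∧
    ∀ i : Fin n, L.plus i i = u (i + 1) ∧ L.minus i i = u i

/-- The zero-curvature relation between `X = (L^(1), L^(2))` and `Y = (L̃^(1), L̃^(2))`. -/
def ZeroCurvature {n : ℕ} {R : Type*} [Ring R] (X Y : LPair n R × LPair n R) : Prop :=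
  X.1.plus * X.2.plus = Y.2.plus * Y.1.plus ∧
  X.1.minus * X.2.plus = Y.2.plus * Y.1.minus ∧
  X.1.minus * X.2.minus = Y.2.minus * Y.1.minus

/-- The block matrix `M`; `Sum.inl k` is the barred index `k̄`, `Sum.inr k` the plain index `k`. -/
def matM {n : ℕ} {R : Type*} [Ring R] (X : LPair n R × LPair n R) :
    Matrix (Fin n ⊕ Fin n) (Fin n ⊕ Fin n) R :=
  Matrix.fromBlocks 0 (X.1.minus * X.2.minus) (X.1.plus * X.2.plus) (X.1.minus * X.2.plus)

/-- The block matrix `M̃`; `Sum.inl k` is the barred index `k̄`, `Sum.inr k` the plain index `k`. -/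
def matMt {n : ℕ} {R : Type*} [Ring R] (Y : LPair n R × LPair n R) :
    Matrix (Fin n ⊕ Fin n) (Fin n ⊕ Fin n) R :=
  Matrix.fromBlocks 0 (Y.2.plus * Y.1.plus) (Y.2.minus * Y.1.minus) (Y.2.plus * Y.1.minus)

/-- A set of plain (unbarred) indices of the block matrices. -/
def plain {n : ℕ} (S : Finset (Fin n)) : Finset (Fin n ⊕ Fin n) :=
  S.map Function.Embedding.inr

/-- The ordered product `f 0 * f 1 * ⋯ * f (i - 1)`. -/
def prodRight {n : ℕ} {R : Type*} [Ring R] (f : Fin n → R) (i : Fin n) : R :=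
  (List.ofFn fun k : Fin i => f (Fin.castLE i.isLt.le k)).prod

/-- The ordered product `f (i - 1) * ⋯ * f 1 * f 0`. -/
def prodLeft {n : ℕ} {R : Type*} [Ring R] (f : Fin n → R) (i : Fin n) : R :=
  (List.ofFn fun k : Fin i => f (Fin.castLE i.isLt.le k)).reverse.prod

section Maps

open Sum

/-- `q^{k+1,…,n}_{a b}` of the rows `k, …, n` of `M`. -/
noncomputable def qM {n : ℕ} {R : Type*} [Ring R] (X : LPair n R × LPair n R) (k : Fin n)
    (a b : Fin n ⊕ Fin n) : R :=
  leftQP (matM X) (plain (Finset.Ici k)) (plain (Finset.Ioi k)) a b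

/-- `r^{k+1,…,n}_{a b}` of the columns `k, …, n` of `M`. -/
noncomputable def rM {n : ℕ} {R : Type*} [Ring R] (X : LPair n R × LPair n R) (k : Fin n)
    (a b : Fin n ⊕ Fin n) : R :=
  rightQP (matM X) (plain (Finset.Ici k)) (plain (Finset.Ioi k)) a b

/-- `q^{1,…,k-1}_{a b}` of the rows `1, …, k` of `M̃`. -/
noncomputable def qMt {n : ℕ} {R : Type*} [Ring R] (Y : LPair n R × LPair n R) (k : Fin n)
    (a b : Fin n ⊕ Fin n) : R :=
  leftQP (matMt Y) (plain (Finset.Iic k)) (plain (Finset.Iio k)) a b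

/-- `r^{1,…,k-1}_{a b}` of the columns `1, …, k` of `M̃`. -/
noncomputable def rMt {n : ℕ} {R : Type*} [Ring R] (Y : LPair n R × LPair n R) (k : Fin n)
    (a b : Fin n ⊕ Fin n) : R :=
  rightQP (matMt Y) (plain (Finset.Iic k)) (plain (Finset.Iio k)) a b

/-- The map `(L^(1), L^(2)) ↦ (L̃^(1), L̃^(2))` in terms of quasi-Plücker coordinates of `M`. -/
noncomputable def forwardMap {n : ℕ} {R : Type*} [Ring R] (X : LPair n R × LPair n R) :
    LPair n R × LPair n R :=
  ({ plus := Matrix.of fun i j => if i ≤ j then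
        prodRight (fun k => qM X k (inr k) (inl k)) i * qM X i (inr i) (inl j) else 0
     minus := Matrix.of fun j i => if i ≤ j then
        prodRight (fun k => qM X k (inr k) (inl k)) j * qM X j (inr j) (inr i) else 0 },
   { plus := Matrix.of fun i j => if i ≤ j then
        rM X j (inr i) (inl j) * prodLeft (fun k => rM X k (inr k) (inl k)) j else 0
     minus := Matrix.of fun j i => if i ≤ j then
        rM X i (inl j) (inl i) * prodLeft (fun k => rM X k (inr k) (inl k)) i else 0 })

/-- The map `(L̃^(1), L̃^(2)) ↦ (L^(1), L^(2))` in terms of quasi-Plücker coordinates of `M̃`. -/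
noncomputable def backwardMap {n : ℕ} {R : Type*} [Ring R] (Y : LPair n R × LPair n R) :
    LPair n R × LPair n R :=
  ({ plus := Matrix.of fun i j => if i ≤ j then
        rMt Y j (inl i) (inr j) * prodLeft (fun k => rMt Y k (inl k) (inr k)) j else 0
     minus := Matrix.of fun j i => if i ≤ j then
        rMt Y i (inr j) (inr i) * prodLeft (fun k => rMt Y k (inl k) (inr k)) i else 0 },
   { plus := Matrix.of fun i j => if i ≤ j then
        prodRight (fun k => qMt Y k (inl k) (inr k)) i * qMt Y i (inl i) (inr j) else 0
     minus := Matrix.of fun j i => if i ≤ j then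
        prodRight (fun k => qMt Y k (inl k) (inr k)) j * qMt Y j (inl j) (inl i) else 0 })

/-- All quasi-Plücker coordinates in the formulas of `forwardMap X` are well defined. -/
def ForwardDefined {n : ℕ} {R : Type*} [Ring R] (X : LPair n R × LPair n R) : Prop :=
  let q := fun (k : Fin n) (a b : Fin n ⊕ Fin n) =>
    LeftQPDefined (matM X) (plain (Finset.Ici k)) (plain (Finset.Ioi k)) a b
  let r := fun (k : Fin n) (a b : Fin n ⊕ Fin n) =>
    RightQPDefined (matM X) (plain (Finset.Ici k)) (plain (Finset.Ioi k)) a b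
  (∀ k, q k (inr k) (inl k) ∧ r k (inr k) (inl k)) ∧
  ∀ i j, i ≤ j → q i (inr i) (inl j) ∧ q j (inr j) (inr i) ∧
    r j (inr i) (inl j) ∧ r i (inl j) (inl i)

/-- All quasi-Plücker coordinates in the formulas of `backwardMap Y` are well defined. -/
def BackwardDefined {n : ℕ} {R : Type*} [Ring R] (Y : LPair n R × LPair n R) : Prop :=
  let q := fun (k : Fin n) (a b : Fin n ⊕ Fin n) =>
    LeftQPDefined (matMt Y) (plain (Finset.Iic k)) (plain (Finset.Iio k)) a b
  let r := fun (k : Fin n) (a b : Fin n ⊕ Fin n) =>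
    RightQPDefined (matMt Y) (plain (Finset.Iic k)) (plain (Finset.Iio k)) a b
  (∀ k, q k (inl k) (inr k) ∧ r k (inl k) (inr k)) ∧
  ∀ i j, i ≤ j → r j (inl i) (inr j) ∧ r i (inr j) (inr i) ∧
    q i (inl i) (inr j) ∧ q j (inl j) (inl i)

end Maps

/-- The domain of the forward map: `L^(1)`, `L^(2)` have the prescribed shape, and with
`J = L^{-(1)} L^{+(2)}` the quasi-determinants `|J^{k,…,n}_{k,…,n}|_{kk}` are well defined and
invertible. -/
def ForwardDomain {n : ℕ} {R : Type*} [Ring R] (X : LPair n R × LPair n R) : Prop :=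
  X.1.IsLOperator ∧ X.2.IsLOperator ∧ ∀ k : Fin n,
    QuasidetDefined (X.1.minus * X.2.plus) (Finset.Ici k) (Finset.Ici k) k k ∧
    IsUnit (quasidet (X.1.minus * X.2.plus) (Finset.Ici k) (Finset.Ici k) k k)

/-- The domain of the backward map: `L̃^(1)`, `L̃^(2)` have the prescribed shape, and with
`J̃ = L̃^{+(2)} L̃^{-(1)}` the quasi-determinants `|J̃^{1,…,k}_{1,…,k}|_{kk}` are well defined and
invertible. -/
def BackwardDomain {n : ℕ} {R : Type*} [Ring R] (Y : LPair n R × LPair n R) : Prop :=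
  Y.1.IsLOperator ∧ Y.2.IsLOperator ∧ ∀ k : Fin n,
    QuasidetDefined (Y.2.plus * Y.1.minus) (Finset.Iic k) (Finset.Iic k) k k ∧
    IsUnit (quasidet (Y.2.plus * Y.1.minus) (Finset.Iic k) (Finset.Iic k) k k)

/-! The zero-curvature relation is a refactorization problem, and the quasi-Plücker formulas write
down its solution. Suppose (ZC) holds between `X` and `Y`. Then the plain rows of M are L̃^{+(2)}
times the block row (L̃^{+(1)} | L̃^{-(1)}), and its plain columns are the block column (L̃^{-(2)} ;
L̃^{+(2)}) times L̃^{-(1)}. Multiplying by row k of the inverse of the upper triangular L̃^{+(2)}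
stays inside the rows k,…,n, and row k of the lower triangular L̃^{-(1)} vanishes in the columns
k+1,…,n. Hence each relevant quasi-determinant is one entry of the block row times a diagonal unit
(`quasidet_left_of_factor`, with mirror `quasidet_right_of_factor`). In the quotients that unit
cancels, and the ordered products telescope to the remaining normalization. So the formulas return
`Y`: `ZeroCurvature.forward`. With triangularities exchanged, M̃ returns `X`:
`ZeroCurvature.backward`. Both also give the domain conditions and the well-definedness of the
coordinates.

It remains to find a partner satisfying (ZC) for each point of a domain
(`ForwardDomain.exists_zeroCurvature`, `BackwardDomain.exists_zeroCurvature`). Invertible corner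
quasi-determinants allow Gauss elimination (`exists_elimination`), so J is upper times lower
triangular, and the other two matrices are then forced by (ZC). The factorization is unique only up
to an invertible diagonal matrix; this freedom is used to make the diagonals fit the L-operator
pattern, which amounts to a two-term recursion in the unit group. -/

/-! ### Triangular matrices over a noncommutative ring and their inverses. -/

section Triangular

variable {R n : Type*} [Ring R] [Fintype n] [LinearOrder n]

/-- The subring of upper triangular matrices. -/
def upperTriangular (R n : Type*) [Ring R] [Fintype n] [LinearOrder n] :
    Subring (Matrix n n R) where
  carrier := {M | ∀ i j, j < i → M i j = 0}
  mul_mem' {A B} hA hB i j h := by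
    rw [Matrix.mul_apply]
    refine Finset.sum_eq_zero fun k _ => ?_
    rcases lt_or_ge k i with hk | hk
    · rw [hA i k hk, zero_mul]
    · rw [hB k j (h.trans_le hk), mul_zero]
  one_mem' i j h := Matrix.one_apply_ne h.ne'
  add_mem' {A B} hA hB i j h := by rw [Matrix.add_apply, hA i j h, hB i j h, add_zero]
  zero_mem' _ _ _ := rfl
  neg_mem' {A} hA i j h := by rw [Matrix.neg_apply, hA i j h, neg_zero]

theorem upper_mul_diag {A B : Matrix n n R} (hA : ∀ i j, j < i → A i j = 0)
    (hB : ∀ i j, j < i → B i j = 0) (i : n) : (A * B) i i = A i i * B i i := by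
  rw [Matrix.mul_apply]
  refine Finset.sum_eq_single i (fun k _ hk => ?_) (fun h => absurd (Finset.mem_univ i) h)
  rcases lt_or_gt_of_ne hk with h | h
  · rw [hA i k h, zero_mul]
  · rw [hB k i h, mul_zero]

/-- Each factor of `N` moves to a strictly larger index, so the number `c i` of indices above `i`
drops at every step and paths of length exceeding the number of indices do not exist. -/
theorem strictUpper_isNilpotent {N : Matrix n n R} (hN : ∀ i j, j ≤ i → N i j = 0) :
    IsNilpotent N := by
  let c : n → ℕ := fun i => (Finset.univ.filter (i < ·)).card
  have key : ∀ m : ℕ, ∀ i j, c i < m + c j → (N ^ m) i j = 0 := by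
    intro m
    induction m with
    | zero =>
      intro i j h
      rw [pow_zero, Matrix.one_apply_ne]
      rintro rfl
      omega
    | succ m ih =>
      intro i j h
      rw [pow_succ', Matrix.mul_apply]
      refine Finset.sum_eq_zero fun k _ => ?_
      rcases le_or_gt k i with hk | hk
      · rw [hN i k hk, zero_mul]
      · rw [ih k j, mul_zero]
        have : c k < c i := by
          refine Finset.card_lt_card (Finset.ssubset_iff_of_subset ?_ |>.2 ⟨k, ?_, ?_⟩)
          · intro l hl
            simp only [Finset.mem_filter, Finset.mem_univ, true_and] at hl ⊢
            exact hk.trans hl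
          · simpa using hk
          · simp
        omega
  refine ⟨Fintype.card n + 1, Matrix.ext fun i j => key _ i j ?_⟩
  have : c i ≤ Fintype.card n := Finset.card_le_univ _
  omega

/-- An upper triangular matrix with invertible diagonal has an upper triangular inverse. -/
theorem exists_upper_unit {A : Matrix n n R} (hA : ∀ i j, j < i → A i j = 0)
    (hd : ∀ i, IsUnit (A i i)) :
    ∃ U : (Matrix n n R)ˣ, U.val = A ∧ (∀ i j, j < i → U⁻¹.val i j = 0) := by
  choose d hd using hd
  let D : (upperTriangular R n)ˣ :=
    { val := ⟨Matrix.diagonal fun i => (d i : R), fun i j h => Matrix.diagonal_apply_ne _ h.ne'⟩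
      inv := ⟨Matrix.diagonal fun i => ((d i)⁻¹ : Rˣ),
        fun i j h => Matrix.diagonal_apply_ne _ h.ne'⟩
      val_inv := Subtype.ext <| by simp [Matrix.diagonal_mul_diagonal]
      inv_val := Subtype.ext <| by simp [Matrix.diagonal_mul_diagonal] }
  let A' : upperTriangular R n := ⟨A, hA⟩
  -- Dividing by the diagonal leaves 1 minus a strictly upper triangular matrix. Nilpotency is
  -- pulled back to the subring, so that the inverse produced below is itself upper triangular.
  have hnil : IsNilpotent (1 - D⁻¹.val * A') := by
    have h : IsNilpotent (1 - D⁻¹.val * A' : upperTriangular R n).val := by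
      refine strictUpper_isNilpotent fun i j h => ?_
      rcases h.lt_or_eq with h | rfl
      · exact (1 - D⁻¹.val * A' : upperTriangular R n).2 i j h
      · simp [D, A', Units.inv_mk, ← hd]
    obtain ⟨m, hm⟩ := h
    exact ⟨m, Subtype.ext <| by simpa using hm⟩
  obtain ⟨V, hV⟩ := hnil.isUnit_one_sub
  rw [sub_sub_cancel] at hV
  refine ⟨Units.map (upperTriangular R n).subtype.toMonoidHom (D * V), ?_, ?_⟩
  · rw [Units.coe_map, Units.val_mul, hV, Units.mul_inv_cancel_left]
    rfl
  · intro i j h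
    exact (D * V)⁻¹.val.2 i j h

theorem lower_mul {A B : Matrix n n R} (hA : ∀ i j, i < j → A i j = 0)
    (hB : ∀ i j, i < j → B i j = 0) : ∀ i j, i < j → (A * B) i j = 0 :=
  (upperTriangular R nᵒᵈ).mul_mem (x := A) (y := B) hA hB

theorem upper_mul {A B : Matrix n n R} (hA : ∀ i j, j < i → A i j = 0)
    (hB : ∀ i j, j < i → B i j = 0) : ∀ i j, j < i → (A * B) i j = 0 :=
  (upperTriangular R n).mul_mem (x := A) (y := B) hA hB

theorem lower_mul_diag {A B : Matrix n n R} (hA : ∀ i j, i < j → A i j = 0)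
    (hB : ∀ i j, i < j → B i j = 0) (i : n) : (A * B) i i = A i i * B i i :=
  upper_mul_diag (n := nᵒᵈ) hA hB i

/-- A lower triangular matrix with invertible diagonal has a lower triangular inverse. -/
theorem exists_lower_unit {A : Matrix n n R} (hA : ∀ i j, i < j → A i j = 0)
    (hd : ∀ i, IsUnit (A i i)) :
    ∃ U : (Matrix n n R)ˣ, U.val = A ∧ (∀ i j, i < j → U⁻¹.val i j = 0) := by
  -- Reversing the order of the indices exchanges lower and upper triangular.
  obtain ⟨U, h1, h2⟩ := exists_upper_unit (n := nᵒᵈ) hA hd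
  exact ⟨⟨U.val, U⁻¹.val, U.mul_inv, U.inv_mul⟩, h1, h2⟩

end Triangular

/-! ### Invertible blocks of factored matrices. -/

section Submatrix

variable {R n ι κ : Type*} [Ring R] [Fintype n]

theorem submatrix_mul_of_left {A B : Matrix n n R} {S : Finset n}
    (h : ∀ l ∈ S, ∀ m ∉ S, A l m = 0) :
    (A * B).submatrix ((↑) : S → n) (↑) =
      A.submatrix ((↑) : S → n) ((↑) : S → n) * B.submatrix (↑) (↑) := by
  ext i j
  simp only [Matrix.submatrix_apply, Matrix.mul_apply]
  rw [Finset.sum_coe_sort S (fun x => A i x * B x j)]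
  refine (Finset.sum_subset (Finset.subset_univ S) fun x _ hx => ?_).symm
  rw [h i i.2 x hx, zero_mul]

theorem submatrix_mul_of_right {A B : Matrix n n R} {S : Finset n}
    (h : ∀ l ∉ S, ∀ m ∈ S, B l m = 0) :
    (A * B).submatrix ((↑) : S → n) (↑) =
      A.submatrix ((↑) : S → n) ((↑) : S → n) * B.submatrix (↑) (↑) := by
  ext i j
  simp only [Matrix.submatrix_apply, Matrix.mul_apply]
  rw [Finset.sum_coe_sort S (fun x => A i x * B x j)]
  refine (Finset.sum_subset (Finset.subset_univ S) fun x _ hx => ?_).symm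
  rw [h x hx j j.2, mul_zero]

/-- If `A = U * C` with `U`, `C` block triangular of opposite kinds with respect to `S`, and the
same for the inverses, then the submatrix of `A` with rows and columns `S` is invertible. -/
theorem exists_isBlockInv_of_factor [DecidableEq n] {A : Matrix ι κ R} {f : n ↪ ι} {g : n ↪ κ} {S : Finset n}
    (U C : (Matrix n n R)ˣ) (hA : ∀ l m, A (f l) (g m) = (U.val * C.val) l m)
    (hU : ∀ l ∈ S, ∀ m ∉ S, U.val l m = 0) (hU' : ∀ l ∈ S, ∀ m ∉ S, U⁻¹.val l m = 0)
    (hC : ∀ l ∉ S, ∀ m ∈ S, C.val l m = 0) (hC' : ∀ l ∉ S, ∀ m ∈ S, C⁻¹.val l m = 0) :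
    ∃ X, IsBlockInv A (S.map f) (S.map g) X := by
  let res : Matrix n n R → Matrix S S R := fun M => M.submatrix (↑) (↑)
  have res1 : res 1 = 1 := Matrix.submatrix_one _ Subtype.val_injective
  have u1 : res U.val * res U⁻¹.val = 1 := by
    rw [← res1, ← U.mul_inv]; exact (submatrix_mul_of_left hU).symm
  have u2 : res U⁻¹.val * res U.val = 1 := by
    rw [← res1, ← U.inv_mul]; exact (submatrix_mul_of_left hU').symm
  have c1 : res C.val * res C⁻¹.val = 1 := by
    rw [← res1, ← C.mul_inv]; exact (submatrix_mul_of_right hC').symm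
  have c2 : res C⁻¹.val * res C.val = 1 := by
    rw [← res1, ← C.inv_mul]; exact (submatrix_mul_of_right hC).symm
  have hJ : res (U.val * C.val) = res U.val * res C.val := submatrix_mul_of_left hU
  set Y : Matrix S S R := res C⁻¹.val * res U⁻¹.val with hY
  have e1 : res (U.val * C.val) * Y = 1 := by
    rw [hJ, hY, Matrix.mul_assoc, ← Matrix.mul_assoc (res C.val), c1, Matrix.one_mul, u1]
  have e2 : Y * res (U.val * C.val) = 1 := by
    rw [hJ, hY, Matrix.mul_assoc, ← Matrix.mul_assoc (res U⁻¹.val), u2, Matrix.one_mul, c2]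
  let g' : S → κ := fun k => g k
  let f' : S → ι := fun l => f l
  have hg : Function.Injective g' := g.injective.comp Subtype.val_injective
  have hf : Function.Injective f' := f.injective.comp Subtype.val_injective
  -- The inverse of the block, transported along the embeddings; the zeros outside the block are
  -- irrelevant to `IsBlockInv`.
  let X : Matrix κ ι R := Function.extend g' (fun k => Function.extend f' (Y k) 0) 0
  have hX : ∀ k l : S, X (g k) (f l) = Y k l := by
    intro k l
    change Function.extend g' (fun k => Function.extend f' (Y k) (0 : ι → R)) 0 (g' k) (f' l) = _
    rw [hg.extend_apply, hf.extend_apply]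
  refine ⟨X, ?_, ?_⟩
  · simp only [Finset.mem_map, Finset.sum_map, forall_exists_index, and_imp,
      forall_apply_eq_imp_iff₂, EmbeddingLike.apply_eq_iff_eq]
    intro l hl l' hl'
    have := congrFun (congrFun e1 ⟨l, hl⟩) ⟨l', hl'⟩
    rw [Matrix.mul_apply, Matrix.one_apply] at this
    rw [← Finset.sum_coe_sort]
    simp only [Subtype.mk.injEq] at this
    refine (Finset.sum_congr rfl fun k _ => ?_).trans (this.trans (by congr))
    rw [hA, hX k ⟨l', hl'⟩]
    rfl
  · simp only [Finset.mem_map, Finset.sum_map, forall_exists_index, and_imp,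
      forall_apply_eq_imp_iff₂, EmbeddingLike.apply_eq_iff_eq]
    intro l hl l' hl'
    have := congrFun (congrFun e2 ⟨l, hl⟩) ⟨l', hl'⟩
    rw [Matrix.mul_apply, Matrix.one_apply] at this
    rw [← Finset.sum_coe_sort]
    simp only [Subtype.mk.injEq] at this
    refine (Finset.sum_congr rfl fun k _ => ?_).trans (this.trans (by congr))
    rw [hA, hX ⟨l, hl⟩ k]
    rfl

end Submatrix

/-! ### Quasi-determinants and quasi-Plücker coordinates of factored matrices. -/

section Factored

variable {R n ι κ : Type*} [Ring R] [Fintype n] [DecidableEq n] [DecidableEq ι] [DecidableEq κ]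

/-- The quasi-determinants of the rows `insert k S` of a matrix `U * B`, where `U` and the columns
`C` of `B` are block triangular of opposite kinds. -/
theorem quasidet_left_of_factor {A : Matrix ι κ R} {f : n ↪ ι} {g : n ↪ κ} {S T : Finset n}
    (U C : (Matrix n n R)ˣ) (B : Matrix n κ R) {k : n} (hk : k ∉ S) (hT : T = insert k S)
    (hA : ∀ l c, A (f l) c = (U.val * B) l c) (hBC : ∀ l m, B l (g m) = C.val l m)
    (hU : ∀ l ∈ S, ∀ m ∉ S, U.val l m = 0) (hU' : ∀ l ∈ S, ∀ m ∉ S, U⁻¹.val l m = 0)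
    (hC : ∀ l ∉ S, ∀ m ∈ S, C.val l m = 0) (hC' : ∀ l ∉ S, ∀ m ∈ S, C⁻¹.val l m = 0)
    (hkT : ∀ l ∉ T, U⁻¹.val k l = 0) (u : Rˣ) (hu : U⁻¹.val k k = (u⁻¹ : Rˣ))
    {a : κ} (ha : a ∉ S.map g) :
    QuasidetDefined A (T.map f) (insert a (S.map g)) (f k) a ∧
      quasidet A (T.map f) (insert a (S.map g)) (f k) a = u * B k a := by
  subst hT
  have hfk : f k ∉ S.map f := by simpa using hk
  have hS : ((insert k S).map f).erase (f k) = S.map f := by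
    rw [Finset.map_insert, Finset.erase_insert hfk]
  have hmem : f k ∈ (insert k S).map f := Finset.mem_map_of_mem _ (Finset.mem_insert_self _ _)
  have hinv : ∃ X, IsBlockInv A (((insert k S).map f).erase (f k)) (S.map g) X := by
    rw [hS]
    refine exists_isBlockInv_of_factor U C (fun l m => ?_) hU hU' hC hC'
    rw [hA, Matrix.mul_apply, Matrix.mul_apply]
    simp only [hBC]
  refine ⟨⟨hmem, Finset.mem_insert_self _ _, ?_, ?_⟩, ?_⟩
  · rw [Finset.card_map, Finset.card_insert_of_notMem hk, Finset.card_insert_of_notMem ha,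
      Finset.card_map]
  · rwa [Finset.erase_insert ha]
  -- Row `k` of `U⁻¹` is the elimination row: it is supported on `T`, and it turns `A` into row `k`
  -- of `B`, which vanishes on the columns `S.map g`. Then `left_aux` reads off the
  -- quasi-determinant, up to the diagonal entry of `U⁻¹`.
  · let v : ι → R := Function.extend f (fun l => U⁻¹.val k l) 0
    have hv : ∀ l, v (f l) = U⁻¹.val k l := fun l => f.injective.extend_apply _ _ _
    have hvA : ∀ c, ∑ l ∈ (insert k S).map f, v l * A l c = B k c := by
      intro c
      rw [Finset.sum_map]
      simp only [hv, hA]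
      rw [Finset.sum_subset (Finset.subset_univ _) fun x _ hx => by rw [hkT x hx, zero_mul],
        ← Matrix.mul_apply, ← Matrix.mul_assoc, U.inv_mul, Matrix.one_mul]
    have := left_aux A _ (S.map g) a (f k) ha hmem hinv v (by
      intro c hc
      obtain ⟨m, hm, rfl⟩ := Finset.mem_map.1 hc
      rw [hvA, hBC, hC k hk m hm])
    rw [hvA, hv, hu] at this
    rw [this, Units.mul_inv_cancel_left]

/-- The quasi-determinants of the columns `insert k S` of a matrix `B * C`, where `C` and the rows
`U` of `B` are block triangular of opposite kinds. -/
theorem quasidet_right_of_factor {A : Matrix ι κ R} {f : n ↪ ι} {g : n ↪ κ} {S T : Finset n}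
    (U C : (Matrix n n R)ˣ) (B : Matrix ι n R) {k : n} (hk : k ∉ S) (hT : T = insert k S)
    (hA : ∀ r m, A r (g m) = (B * C.val) r m) (hBU : ∀ l m, B (f l) m = U.val l m)
    (hU : ∀ l ∈ S, ∀ m ∉ S, U.val l m = 0) (hU' : ∀ l ∈ S, ∀ m ∉ S, U⁻¹.val l m = 0)
    (hC : ∀ l ∉ S, ∀ m ∈ S, C.val l m = 0) (hC' : ∀ l ∉ S, ∀ m ∈ S, C⁻¹.val l m = 0)
    (hkT : ∀ l ∉ T, C⁻¹.val l k = 0) (u : Rˣ) (hu : C⁻¹.val k k = (u⁻¹ : Rˣ))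
    {a : ι} (ha : a ∉ S.map f) :
    QuasidetDefined A (insert a (S.map f)) (T.map g) a (g k) ∧
      quasidet A (insert a (S.map f)) (T.map g) a (g k) = B a k * u := by
  subst hT
  have hgk : g k ∉ S.map g := by simpa using hk
  have hS : ((insert k S).map g).erase (g k) = S.map g := by
    rw [Finset.map_insert, Finset.erase_insert hgk]
  have hmem : g k ∈ (insert k S).map g := Finset.mem_map_of_mem _ (Finset.mem_insert_self _ _)
  have hinv : ∃ X, IsBlockInv A (S.map f) (((insert k S).map g).erase (g k)) X := by
    rw [hS]
    refine exists_isBlockInv_of_factor U C (fun l m => ?_) hU hU' hC hC'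
    rw [hA, Matrix.mul_apply, Matrix.mul_apply]
    simp only [hBU]
  refine ⟨⟨Finset.mem_insert_self _ _, hmem, ?_, ?_⟩, ?_⟩
  · rw [Finset.card_map, Finset.card_insert_of_notMem hk, Finset.card_insert_of_notMem ha,
      Finset.card_map]
  · rwa [Finset.erase_insert ha]
  · let v : κ → R := Function.extend g (fun l => C⁻¹.val l k) 0
    have hv : ∀ l, v (g l) = C⁻¹.val l k := fun l => g.injective.extend_apply _ _ _
    have hvA : ∀ c, ∑ l ∈ (insert k S).map g, A c l * v l = B c k := by
      intro c
      rw [Finset.sum_map]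
      simp only [hv, hA]
      rw [Finset.sum_subset (Finset.subset_univ _) fun x _ hx => by rw [hkT x hx, mul_zero],
        ← Matrix.mul_apply, Matrix.mul_assoc, C.mul_inv, Matrix.mul_one]
    have := right_aux A _ (S.map f) a (g k) ha hmem hinv v (by
      intro c hc
      obtain ⟨m, hm, rfl⟩ := Finset.mem_map.1 hc
      rw [hvA, hBU, hU m hm k hk])
    rw [hvA, hv, hu] at this
    rw [this, Units.inv_mul_cancel_right]

/-- The common left factor `u`, contributed by the outer triangular matrix, cancels in the quotient.
-/
theorem leftQP_of_quasidet {A : Matrix ι κ R} {I : Finset ι} {J : Finset κ} {s : ι} {u x : Rˣ}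
    {a b : κ} {z : R} (ha : a ∉ J)
    (h1 : QuasidetDefined A I (insert a J) s a ∧ quasidet A I (insert a J) s a = u * x)
    (h2 : QuasidetDefined A I (insert b J) s b ∧ quasidet A I (insert b J) s b = u * z) :
    LeftQPDefined A I J a b ∧ leftQP A I J a b = (x⁻¹ : Rˣ) * z := by
  have h : LeftQPAdmissible A I J a b s :=
    ⟨ha, h1.1, h2.1, h1.2 ▸ u.isUnit.mul x.isUnit⟩
  refine ⟨⟨s, h⟩, ?_⟩
  rw [leftQP_eq h, h1.2, h2.2, ← Units.val_mul, Ring.inverse_unit, mul_inv_rev, Units.val_mul,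
    mul_assoc, Units.inv_mul_cancel_left]

theorem rightQP_of_quasidet {A : Matrix ι κ R} {K : Finset κ} {J : Finset ι} {t : κ} {u x : Rˣ}
    {a b : ι} {z : R} (hb : b ∉ J)
    (h1 : QuasidetDefined A (insert a J) K a t ∧ quasidet A (insert a J) K a t = z * u)
    (h2 : QuasidetDefined A (insert b J) K b t ∧ quasidet A (insert b J) K b t = x * u) :
    RightQPDefined A K J a b ∧ rightQP A K J a b = z * (x⁻¹ : Rˣ) := by
  have h : RightQPAdmissible A K J a b t :=
    ⟨hb, h1.1, h2.1, h2.2 ▸ x.isUnit.mul u.isUnit⟩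
  refine ⟨⟨t, h⟩, ?_⟩
  rw [rightQP_eq h, h1.2, h2.2, ← Units.val_mul, Ring.inverse_unit, mul_inv_rev, Units.val_mul,
    mul_assoc, Units.mul_inv_cancel_left]

/-- Gauss elimination: if the quasi-determinants `|J^{k,S k}_{k,S k}|_{kk}` are well defined, then
there is a matrix `W` with unit diagonal, supported on the index pairs `l ∈ insert k (S k)`,
such that row `k` of `W * J` vanishes on `S k` and has these quasi-determinants on the diagonal. -/
theorem exists_elimination (J : Matrix n n R) (S T : n → Finset n) (hk : ∀ k, k ∉ S k)
    (hT : ∀ k, T k = insert k (S k)) (h : ∀ k, QuasidetDefined J (T k) (T k) k k) :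
    ∃ W : Matrix n n R, (∀ k, W k k = 1) ∧ (∀ k, ∀ l ∉ T k, W k l = 0) ∧
      (∀ k, ∀ m ∈ S k, (W * J) k m = 0) ∧ ∀ k, (W * J) k k = quasidet J (T k) (T k) k k := by
  have hin : ∀ k, k ∈ T k := fun k => (h k).1
  have hinv : ∀ k, ∃ X, IsBlockInv J ((T k).erase k) (S k) X := fun k => by
    have := (h k).2.2.2
    rwa [show (T k).erase k = S k by rw [hT, Finset.erase_insert (hk k)]] at this ⊢
  choose v hv1 hv2 using fun k => exists_left_row J (T k) (S k) k (hin k) (hinv k)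
  -- The row `v k` matters only on `T k`; cutting it off there turns sums over `T k` into entries of
  -- a matrix product.
  let W : Matrix n n R := fun k l => if l ∈ T k then v k l else 0
  have hW : ∀ k m, (W * J) k m = ∑ l ∈ T k, v k l * J l m := fun k m => by
    rw [Matrix.mul_apply, ← Finset.sum_subset (Finset.subset_univ (T k))]
    · exact Finset.sum_congr rfl fun l hl => by simp only [W, if_pos hl]
    · intro l _ hl
      simp only [W, if_neg hl, zero_mul]
  refine ⟨W, fun k => ?_, fun k l hl => if_neg hl, fun k m hm => ?_, fun k => ?_⟩
  · simp only [W, if_pos (hin k), hv1]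
  · rw [hW, hv2 k m hm]
  · rw [hW, left_aux J (T k) (S k) k k (hk k) (hin k) (hinv k) (v k) (hv2 k), hv1, one_mul,
      ← hT]

end Factored
-- L-operators: units, telescoping products, and quasi-determinants.
section LOperators

open Sum

variable {n : ℕ} {R : Type*} [Ring R]

/-- The two triangular matrices of an L-operator as units of the matrix ring, with the diagonals of
the matrices and of their inverses. -/
structure LPair.HasUnits (L : LPair n R) (u : ℕ → Rˣ) (U C : (Matrix (Fin n) (Fin n) R)ˣ) :
    Prop where
  zero : u 0 = 1
  plus : U.val = L.plus
  minus : C.val = L.minus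
  upper : ∀ i j, j < i → U.val i j = 0
  lower : ∀ i j, i < j → C.val i j = 0
  upper_inv : ∀ i j, j < i → U⁻¹.val i j = 0
  lower_inv : ∀ i j, i < j → C⁻¹.val i j = 0
  upper_diag : ∀ i : Fin n, U.val i i = u (i + 1)
  lower_diag : ∀ i : Fin n, C.val i i = u i

theorem upper_inv_diag {U : (Matrix (Fin n) (Fin n) R)ˣ}
    (h : ∀ i j, j < i → U.val i j = 0) (h' : ∀ i j, j < i → U⁻¹.val i j = 0) {i : Fin n} {x : Rˣ}
    (hd : U.val i i = x) : U⁻¹.val i i = (x⁻¹ : Rˣ) := by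
  have := upper_mul_diag h' h i
  rw [U.inv_mul, Matrix.one_apply_eq, hd] at this
  exact Units.eq_inv_of_mul_eq_one_right this.symm

theorem lower_inv_diag {U : (Matrix (Fin n) (Fin n) R)ˣ}
    (h : ∀ i j, i < j → U.val i j = 0) (h' : ∀ i j, i < j → U⁻¹.val i j = 0) {i : Fin n} {x : Rˣ}
    (hd : U.val i i = x) : U⁻¹.val i i = (x⁻¹ : Rˣ) := by
  have := lower_mul_diag h' h i
  rw [U.inv_mul, Matrix.one_apply_eq, hd] at this
  exact Units.eq_inv_of_mul_eq_one_right this.symm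

theorem LPair.IsLOperator.exists_hasUnits {L : LPair n R} (h : L.IsLOperator) :
    ∃ u U C, L.HasUnits u U C := by
  obtain ⟨hp, hm, u, hu0, hu, hd⟩ := h
  choose u' hu' using hu
  obtain ⟨U, hU, hU'⟩ := exists_upper_unit hp fun i => (hd i).1 ▸ ⟨_, hu' _⟩
  obtain ⟨C, hC, hC'⟩ := exists_lower_unit hm fun i => (hd i).2 ▸ ⟨_, hu' _⟩
  exact ⟨u', U, C, Units.ext ((hu' 0).trans hu0), hU, hC, hU ▸ hp, hC ▸ hm, hU', hC',
    fun i => by rw [hU, (hd i).1, hu'], fun i => by rw [hC, (hd i).2, hu']⟩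

theorem LPair.isLOperator_of_units {L : LPair n R} (hp : ∀ i j, j < i → L.plus i j = 0)
    (hm : ∀ i j, i < j → L.minus i j = 0) (u : ℕ → Rˣ) (hu : u 0 = 1)
    (hpd : ∀ i : Fin n, L.plus i i = u (i + 1)) (hmd : ∀ i : Fin n, L.minus i i = u i) :
    L.IsLOperator :=
  ⟨hp, hm, fun k => u k, by simp [hu], fun k => (u k).isUnit, fun i => ⟨hpd i, hmd i⟩⟩

/-- Adjacent factors cancel, and the normalization `u 0 = 1` removes the remaining initial factor.
-/
theorem prodRight_telescope (u : ℕ → Rˣ) (hu : u 0 = 1) (f : Fin n → R)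
    (hf : ∀ k : Fin n, f k = ((u k)⁻¹ : Rˣ) * u (k + 1)) (i : Fin n) : prodRight f i = u i := by
  have key : ∀ m : ℕ,
      (List.ofFn fun k : Fin m => (((u k)⁻¹ * u (k + 1) : Rˣ) : R)).prod = u m := by
    intro m
    induction m with
    | zero => simp [hu]
    | succ m ih =>
      rw [List.ofFn_succ', List.concat_eq_append, List.prod_append]
      simp only [Fin.val_castSucc, ih, Fin.val_last, List.prod_singleton]
      rw [← Units.val_mul, mul_inv_cancel_left]
  rw [← key i, prodRight]
  simp only [hf, Units.val_mul, Fin.val_castLE]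

theorem prodLeft_telescope (u : ℕ → Rˣ) (hu : u 0 = 1) (f : Fin n → R)
    (hf : ∀ k : Fin n, f k = u (k + 1) * ((u k)⁻¹ : Rˣ)) (i : Fin n) : prodLeft f i = u i := by
  have key : ∀ m : ℕ,
      (List.ofFn fun k : Fin m => ((u (k + 1) * (u k)⁻¹ : Rˣ) : R)).reverse.prod = u m := by
    intro m
    induction m with
    | zero => simp [hu]
    | succ m ih =>
      rw [List.ofFn_succ', List.concat_eq_append, List.reverse_append, List.prod_append]
      simp only [Fin.val_castSucc, ih, Fin.val_last, List.reverse_singleton, List.prod_singleton]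
      rw [← Units.val_mul, inv_mul_cancel_right]
  rw [← key i, prodLeft]
  simp only [hf, Units.val_mul, Fin.val_castLE]

theorem Ici_eq_insert_Ioi (k : Fin n) : Finset.Ici k = insert k (Finset.Ioi k) :=
  (Finset.Ioi_insert k).symm

theorem Iic_eq_insert_Iio (k : Fin n) : Finset.Iic k = insert k (Finset.Iio k) :=
  (Finset.Iio_insert k).symm

theorem inl_notMem_plain (i : Fin n) (S : Finset (Fin n)) : inl i ∉ plain S := by
  simp [plain]

theorem inr_mem_plain {i : Fin n} {S : Finset (Fin n)} : inr i ∈ plain S ↔ i ∈ S := by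
  simp [plain]

variable {X Y : LPair n R × LPair n R}
  {u₁ u₂ v₁ v₂ : ℕ → Rˣ} {U₁ C₁ U₂ C₂ V₁ D₁ V₂ D₂ : (Matrix (Fin n) (Fin n) R)ˣ}

/-- The embeddings `f` and `g` are kept general so that one statement covers both the plain block of
M and J itself. The factor `v₂ (k + 1)` is the diagonal entry of L̃^{+(2)}. -/
theorem quasidet_left_forward (hY₁ : Y.1.HasUnits v₁ V₁ D₁) (hY₂ : Y.2.HasUnits v₂ V₂ D₂)
    {ι κ : Type*} [DecidableEq ι] [DecidableEq κ] (f : Fin n ↪ ι) (g : Fin n ↪ κ)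
    {A : Matrix ι κ R} (B : Matrix (Fin n) κ R) (hA : ∀ l c, A (f l) c = (Y.2.plus * B) l c)
    (hB : ∀ l m, B l (g m) = Y.1.minus l m) (k : Fin n) {a : κ}
    (ha : a ∉ (Finset.Ioi k).map g) :
    QuasidetDefined A ((Finset.Ici k).map f) (insert a ((Finset.Ioi k).map g)) (f k) a ∧
      quasidet A ((Finset.Ici k).map f) (insert a ((Finset.Ioi k).map g)) (f k) a =
        v₂ (k + 1) * B k a := by
  refine quasidet_left_of_factor V₂ D₁ B (by simp) (Ici_eq_insert_Ioi k)
    (by rw [hY₂.plus]; exact hA) (by rw [hY₁.minus]; exact hB) ?_ ?_ ?_ ?_ ?_ _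
    (upper_inv_diag hY₂.upper hY₂.upper_inv (hY₂.upper_diag k)) ha <;>
    simp only [Finset.mem_Ioi, Finset.mem_Ici, not_lt, not_le]
  · exact fun l hl m hm => hY₂.upper _ _ (hm.trans_lt hl)
  · exact fun l hl m hm => hY₂.upper_inv _ _ (hm.trans_lt hl)
  · exact fun l hl m hm => hY₁.lower _ _ (hl.trans_lt hm)
  · exact fun l hl m hm => hY₁.lower_inv _ _ (hl.trans_lt hm)
  · exact fun l hl => hY₂.upper_inv _ _ hl

theorem quasidet_right_forward (hY₁ : Y.1.HasUnits v₁ V₁ D₁) (hY₂ : Y.2.HasUnits v₂ V₂ D₂)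
    {ι κ : Type*} [DecidableEq ι] [DecidableEq κ] (f : Fin n ↪ ι) (g : Fin n ↪ κ)
    {A : Matrix ι κ R} (B : Matrix ι (Fin n) R) (hA : ∀ r m, A r (g m) = (B * Y.1.minus) r m)
    (hB : ∀ l m, B (f l) m = Y.2.plus l m) (k : Fin n) {a : ι}
    (ha : a ∉ (Finset.Ioi k).map f) :
    QuasidetDefined A (insert a ((Finset.Ioi k).map f)) ((Finset.Ici k).map g) a (g k) ∧
      quasidet A (insert a ((Finset.Ioi k).map f)) ((Finset.Ici k).map g) a (g k) =
        B a k * v₁ k := by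
  refine quasidet_right_of_factor V₂ D₁ B (by simp) (Ici_eq_insert_Ioi k)
    (by rw [hY₁.minus]; exact hA) (by rw [hY₂.plus]; exact hB) ?_ ?_ ?_ ?_ ?_ _
    (lower_inv_diag hY₁.lower hY₁.lower_inv (hY₁.lower_diag k)) ha <;>
    simp only [Finset.mem_Ioi, Finset.mem_Ici, not_lt, not_le]
  · exact fun l hl m hm => hY₂.upper _ _ (hm.trans_lt hl)
  · exact fun l hl m hm => hY₂.upper_inv _ _ (hm.trans_lt hl)
  · exact fun l hl m hm => hY₁.lower _ _ (hl.trans_lt hm)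
  · exact fun l hl m hm => hY₁.lower_inv _ _ (hl.trans_lt hm)
  · exact fun l hl => hY₁.lower_inv _ _ hl

/-- Here the outer factor L^{-(1)} is lower triangular, so elimination uses the initial rows, and
the unit is its diagonal entry `u₁ k`, without index shift. -/
theorem quasidet_left_backward (hX₁ : X.1.HasUnits u₁ U₁ C₁) (hX₂ : X.2.HasUnits u₂ U₂ C₂)
    {ι κ : Type*} [DecidableEq ι] [DecidableEq κ] (f : Fin n ↪ ι) (g : Fin n ↪ κ)
    {A : Matrix ι κ R} (B : Matrix (Fin n) κ R) (hA : ∀ l c, A (f l) c = (X.1.minus * B) l c)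
    (hB : ∀ l m, B l (g m) = X.2.plus l m) (k : Fin n) {a : κ}
    (ha : a ∉ (Finset.Iio k).map g) :
    QuasidetDefined A ((Finset.Iic k).map f) (insert a ((Finset.Iio k).map g)) (f k) a ∧
      quasidet A ((Finset.Iic k).map f) (insert a ((Finset.Iio k).map g)) (f k) a =
        u₁ k * B k a := by
  refine quasidet_left_of_factor C₁ U₂ B (by simp) (Iic_eq_insert_Iio k)
    (by rw [hX₁.minus]; exact hA) (by rw [hX₂.plus]; exact hB) ?_ ?_ ?_ ?_ ?_ _
    (lower_inv_diag hX₁.lower hX₁.lower_inv (hX₁.lower_diag k)) ha <;>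
    simp only [Finset.mem_Iio, Finset.mem_Iic, not_lt, not_le]
  · exact fun l hl m hm => hX₁.lower _ _ (hl.trans_le hm)
  · exact fun l hl m hm => hX₁.lower_inv _ _ (hl.trans_le hm)
  · exact fun l hl m hm => hX₂.upper _ _ (hm.trans_le hl)
  · exact fun l hl m hm => hX₂.upper_inv _ _ (hm.trans_le hl)
  · exact fun l hl => hX₁.lower_inv _ _ hl

theorem quasidet_right_backward (hX₁ : X.1.HasUnits u₁ U₁ C₁) (hX₂ : X.2.HasUnits u₂ U₂ C₂)
    {ι κ : Type*} [DecidableEq ι] [DecidableEq κ] (f : Fin n ↪ ι) (g : Fin n ↪ κ)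
    {A : Matrix ι κ R} (B : Matrix ι (Fin n) R) (hA : ∀ r m, A r (g m) = (B * X.2.plus) r m)
    (hB : ∀ l m, B (f l) m = X.1.minus l m) (k : Fin n) {a : ι}
    (ha : a ∉ (Finset.Iio k).map f) :
    QuasidetDefined A (insert a ((Finset.Iio k).map f)) ((Finset.Iic k).map g) a (g k) ∧
      quasidet A (insert a ((Finset.Iio k).map f)) ((Finset.Iic k).map g) a (g k) =
        B a k * u₂ (k + 1) := by
  refine quasidet_right_of_factor C₁ U₂ B (by simp) (Iic_eq_insert_Iio k)
    (by rw [hX₂.plus]; exact hA) (by rw [hX₁.minus]; exact hB) ?_ ?_ ?_ ?_ ?_ _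
    (upper_inv_diag hX₂.upper hX₂.upper_inv (hX₂.upper_diag k)) ha <;>
    simp only [Finset.mem_Iio, Finset.mem_Iic, not_lt, not_le]
  · exact fun l hl m hm => hX₁.lower _ _ (hl.trans_le hm)
  · exact fun l hl m hm => hX₁.lower_inv _ _ (hl.trans_le hm)
  · exact fun l hl m hm => hX₂.upper _ _ (hm.trans_le hl)
  · exact fun l hl m hm => hX₂.upper_inv _ _ (hm.trans_le hl)
  · exact fun l hl => hX₂.upper_inv _ _ hl

/-! ### Coordinates of the block matrices under zero curvature. -/

/-- The coordinates `q_{k;kb}` of `M` are those of the matrix with blocks `L̃^{+(1)}`,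
`L̃^{-(1)}`. -/
theorem qM_eq (hY₁ : Y.1.HasUnits v₁ V₁ D₁) (hY₂ : Y.2.HasUnits v₂ V₂ D₂)
    (h : ZeroCurvature X Y) (k : Fin n) {b : Fin n ⊕ Fin n} (hb : b ∉ plain (Finset.Ioi k)) :
    LeftQPDefined (matM X) (plain (Finset.Ici k)) (plain (Finset.Ioi k)) (inr k) b ∧
      qM X k (inr k) b = ((v₁ k)⁻¹ : Rˣ) * Matrix.fromCols Y.1.plus Y.1.minus k b := by
  have key := fun a ha => quasidet_left_forward (a := a) hY₁ hY₂ Function.Embedding.inr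
    Function.Embedding.inr (A := matM X) (Matrix.fromCols Y.1.plus Y.1.minus) (by
      rintro l (c | c) <;>
        simp [matM, h.1, h.2.1, Matrix.mul_apply]) (fun l m => rfl) k ha
  have hk : inr k ∉ plain (Finset.Ioi k) := by simp [inr_mem_plain]
  refine leftQP_of_quasidet hk (u := v₂ (k + 1)) (s := inr k) ?_ (key b hb)
  -- In the pivot column `k` the entry is the diagonal unit `v₁ k` of L̃^{-(1)}, so the denominator
  -- is invertible.
  have := key (inr k) hk
  rwa [Matrix.fromCols_apply_inr, ← hY₁.minus, hY₁.lower_diag] at this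

/-- The coordinates `r_{k;ak̄}` of `M` are those of the matrix with blocks `L̃^{-(2)}`,
`L̃^{+(2)}`. -/
theorem rM_eq (hY₁ : Y.1.HasUnits v₁ V₁ D₁) (hY₂ : Y.2.HasUnits v₂ V₂ D₂)
    (h : ZeroCurvature X Y) (k : Fin n) {a : Fin n ⊕ Fin n} (ha : a ∉ plain (Finset.Ioi k)) :
    RightQPDefined (matM X) (plain (Finset.Ici k)) (plain (Finset.Ioi k)) a (inl k) ∧
      rM X k a (inl k) = Matrix.fromRows Y.2.minus Y.2.plus a k * ((v₂ k)⁻¹ : Rˣ) := by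
  have key := fun a ha => quasidet_right_forward (a := a) hY₁ hY₂ Function.Embedding.inr
    Function.Embedding.inr (A := matM X) (Matrix.fromRows Y.2.minus Y.2.plus) (by
      rintro (c | c) l <;>
        simp [matM, h.2.2, h.2.1, Matrix.mul_apply]) (fun l m => rfl) k ha
  have hk := inl_notMem_plain k (Finset.Ioi k)
  refine rightQP_of_quasidet hk (u := v₁ k) (t := inr k) (key a ha) ?_
  have := key (inl k) hk
  rwa [Matrix.fromRows_apply_inl, ← hY₂.minus, hY₂.lower_diag] at this

/-- The coordinates `q̃_{k;k̄b}` of `M̃` are those of the matrix with blocks `L^{-(2)}`,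
`L^{+(2)}`. -/
theorem qMt_eq (hX₁ : X.1.HasUnits u₁ U₁ C₁) (hX₂ : X.2.HasUnits u₂ U₂ C₂)
    (h : ZeroCurvature X Y) (k : Fin n) {b : Fin n ⊕ Fin n} (hb : b ∉ plain (Finset.Iio k)) :
    LeftQPDefined (matMt Y) (plain (Finset.Iic k)) (plain (Finset.Iio k)) (inl k) b ∧
      qMt Y k (inl k) b = ((u₂ k)⁻¹ : Rˣ) * Matrix.fromCols X.2.minus X.2.plus k b := by
  have key := fun a ha => quasidet_left_backward (a := a) hX₁ hX₂ Function.Embedding.inr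
    Function.Embedding.inr (A := matMt Y) (Matrix.fromCols X.2.minus X.2.plus) (by
      rintro l (c | c) <;>
        simp [matMt, ← h.2.2, ← h.2.1, Matrix.mul_apply]) (fun l m => rfl) k ha
  have hk := inl_notMem_plain k (Finset.Iio k)
  refine leftQP_of_quasidet hk (u := u₁ k) (s := inr k) ?_ (key b hb)
  have := key (inl k) hk
  rwa [Matrix.fromCols_apply_inl, ← hX₂.minus, hX₂.lower_diag] at this

/-- The coordinates `r̃_{k;ak}` of `M̃` are those of the matrix with blocks `L^{+(1)}`,
`L^{-(1)}`. -/
theorem rMt_eq (hX₁ : X.1.HasUnits u₁ U₁ C₁) (hX₂ : X.2.HasUnits u₂ U₂ C₂)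
    (h : ZeroCurvature X Y) (k : Fin n) {a : Fin n ⊕ Fin n} (ha : a ∉ plain (Finset.Iio k)) :
    RightQPDefined (matMt Y) (plain (Finset.Iic k)) (plain (Finset.Iio k)) a (inr k) ∧
      rMt Y k a (inr k) = Matrix.fromRows X.1.plus X.1.minus a k * ((u₁ k)⁻¹ : Rˣ) := by
  have key := fun a ha => quasidet_right_backward (a := a) hX₁ hX₂ Function.Embedding.inr
    Function.Embedding.inr (A := matMt Y) (Matrix.fromRows X.1.plus X.1.minus) (by
      rintro (c | c) l <;>
        simp [matMt, ← h.1, ← h.2.1, Matrix.mul_apply]) (fun l m => rfl) k ha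
  have hk : inr k ∉ plain (Finset.Iio k) := by simp [inr_mem_plain]
  refine rightQP_of_quasidet hk (u := u₂ (k + 1)) (t := inr k) (key a ha) ?_
  have := key (inr k) hk
  rwa [Matrix.fromRows_apply_inr, ← hX₁.minus, hX₁.lower_diag] at this

/-! ### Zero curvature determines each side from the other. -/

/-- If the zero-curvature relation holds between `X` and `Y`, then `X` lies in the domain of the
forward map, which sends it to `Y`. -/
theorem ZeroCurvature.forward (h : ZeroCurvature X Y) (hX₁ : X.1.IsLOperator)
    (hX₂ : X.2.IsLOperator) (hY₁ : Y.1.IsLOperator) (hY₂ : Y.2.IsLOperator) :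
    ForwardDomain X ∧ ForwardDefined X ∧ forwardMap X = Y := by
  obtain ⟨v₁, V₁, D₁, h₁⟩ := hY₁.exists_hasUnits
  obtain ⟨v₂, V₂, D₂, h₂⟩ := hY₂.exists_hasUnits
  have hq := fun k b hb => qM_eq (b := b) h₁ h₂ h k hb
  have hr := fun k a ha => rM_eq (a := a) h₁ h₂ h k ha
  have hl := fun i k : Fin n => inl_notMem_plain i (Finset.Ioi k)
  have hn : ∀ i j : Fin n, i ≤ j → inr i ∉ plain (Finset.Ioi j) := fun i j hij => by
    simpa [inr_mem_plain] using hij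
  refine ⟨⟨hX₁, hX₂, fun k => ?_⟩, ⟨fun k => ⟨(hq _ _ (hl _ _)).1, (hr _ _ (hn _ _ le_rfl)).1⟩,
    fun i j hij => ⟨(hq _ _ (hl _ _)).1, (hq _ _ (hn _ _ hij)).1, (hr _ _ (hn _ _ hij)).1,
      (hr _ _ (hl _ _)).1⟩⟩, ?_⟩
  -- With identity embeddings this is a statement about J: its corner quasi-determinant is the
  -- product `v₂ (k + 1) * v₁ k` of units.
  · have := quasidet_left_forward h₁ h₂ (.refl _) (.refl _) (A := X.1.minus * X.2.plus) Y.1.minus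
      (fun l c => by rw [h.2.1]; rfl) (fun _ _ => rfl) k (a := k) (by simp)
    simp only [Finset.map_refl, Function.Embedding.refl_apply, ← Ici_eq_insert_Ioi] at this
    rw [this.2, ← h₁.minus, h₁.lower_diag]
    exact ⟨this.1, (v₂ _).isUnit.mul (v₁ _).isUnit⟩
  -- Each factor is the inverse of `v₁ k` times `v₁ (k + 1)`, so the product up to `i` is `v₁ i`,
  -- exactly what cancels the inverse in `qM_eq`.
  · have hp := prodRight_telescope v₁ h₁.zero (fun k => qM X k (inr k) (inl k)) fun k => by
      rw [(hq _ _ (hl _ _)).2, Matrix.fromCols_apply_inl, ← h₁.plus, h₁.upper_diag]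
    have hp' := prodLeft_telescope v₂ h₂.zero (fun k => rM X k (inr k) (inl k)) fun k => by
      rw [(hr _ _ (hn _ _ le_rfl)).2, Matrix.fromRows_apply_inr, ← h₂.plus, h₂.upper_diag]
    ext i j <;> simp only [forwardMap, Matrix.of_apply] <;> split_ifs with hij
    · rw [hp, (hq _ _ (hl _ _)).2, Units.mul_inv_cancel_left, Matrix.fromCols_apply_inl]
    · rw [← h₁.plus, h₁.upper _ _ (not_le.1 hij)]
    · rw [hp, (hq _ _ (hn _ _ hij)).2, Units.mul_inv_cancel_left, Matrix.fromCols_apply_inr]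
    · rw [← h₁.minus, h₁.lower _ _ (not_le.1 hij)]
    · rw [hp', (hr _ _ (hn _ _ hij)).2, Units.inv_mul_cancel_right, Matrix.fromRows_apply_inr]
    · rw [← h₂.plus, h₂.upper _ _ (not_le.1 hij)]
    · rw [hp', (hr _ _ (hl _ _)).2, Units.inv_mul_cancel_right, Matrix.fromRows_apply_inl]
    · rw [← h₂.minus, h₂.lower _ _ (not_le.1 hij)]

/-- If the zero-curvature relation holds between `X` and `Y`, then `Y` lies in the domain of the
backward map, which sends it to `X`. -/
theorem ZeroCurvature.backward (h : ZeroCurvature X Y) (hX₁ : X.1.IsLOperator)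
    (hX₂ : X.2.IsLOperator) (hY₁ : Y.1.IsLOperator) (hY₂ : Y.2.IsLOperator) :
    BackwardDomain Y ∧ BackwardDefined Y ∧ backwardMap Y = X := by
  obtain ⟨u₁, U₁, C₁, h₁⟩ := hX₁.exists_hasUnits
  obtain ⟨u₂, U₂, C₂, h₂⟩ := hX₂.exists_hasUnits
  have hq := fun k b hb => qMt_eq (b := b) h₁ h₂ h k hb
  have hr := fun k a ha => rMt_eq (a := a) h₁ h₂ h k ha
  have hl := fun i k : Fin n => inl_notMem_plain i (Finset.Iio k)
  have hn : ∀ i j : Fin n, j ≤ i → inr i ∉ plain (Finset.Iio j) := fun i j hij => by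
    simpa [inr_mem_plain] using hij
  refine ⟨⟨hY₁, hY₂, fun k => ?_⟩, ⟨fun k => ⟨(hq _ _ (hn _ _ le_rfl)).1, (hr _ _ (hl _ _)).1⟩,
    fun i j hij => ⟨(hr _ _ (hl _ _)).1, (hr _ _ (hn _ _ hij)).1, (hq _ _ (hn _ _ hij)).1,
      (hq _ _ (hl _ _)).1⟩⟩, ?_⟩
  · have := quasidet_left_backward h₁ h₂ (.refl _) (.refl _) (A := Y.2.plus * Y.1.minus) X.2.plus
      (fun l c => by rw [← h.2.1]; rfl) (fun _ _ => rfl) k (a := k) (by simp)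
    simp only [Finset.map_refl, Function.Embedding.refl_apply, ← Iic_eq_insert_Iio] at this
    rw [this.2, ← h₂.plus, h₂.upper_diag]
    exact ⟨this.1, (u₁ _).isUnit.mul (u₂ _).isUnit⟩
  · have hp := prodRight_telescope u₂ h₂.zero (fun k => qMt Y k (inl k) (inr k)) fun k => by
      rw [(hq _ _ (hn _ _ le_rfl)).2, Matrix.fromCols_apply_inr, ← h₂.plus, h₂.upper_diag]
    have hp' := prodLeft_telescope u₁ h₁.zero (fun k => rMt Y k (inl k) (inr k)) fun k => by
      rw [(hr _ _ (hl _ _)).2, Matrix.fromRows_apply_inl, ← h₁.plus, h₁.upper_diag]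
    ext i j <;> simp only [backwardMap, Matrix.of_apply] <;> split_ifs with hij
    · rw [hp', (hr _ _ (hl _ _)).2, Units.inv_mul_cancel_right, Matrix.fromRows_apply_inl]
    · rw [← h₁.plus, h₁.upper _ _ (not_le.1 hij)]
    · rw [hp', (hr _ _ (hn _ _ hij)).2, Units.inv_mul_cancel_right, Matrix.fromRows_apply_inr]
    · rw [← h₁.minus, h₁.lower _ _ (not_le.1 hij)]
    · rw [hp, (hq _ _ (hn _ _ hij)).2, Units.mul_inv_cancel_left, Matrix.fromCols_apply_inr]
    · rw [← h₂.plus, h₂.upper _ _ (not_le.1 hij)]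
    · rw [hp, (hq _ _ (hl _ _)).2, Units.mul_inv_cancel_left, Matrix.fromCols_apply_inl]
    · rw [← h₂.minus, h₂.lower _ _ (not_le.1 hij)]

end LOperators
-- Triangular factorizations with a prescribed diagonal.
section Factorization

variable {R n : Type*} [Ring R] [Fintype n] [LinearOrder n]

/-- A matrix made lower triangular by left multiplication with a unipotent upper triangular matrix
is the product of an upper triangular matrix with arbitrary invertible diagonal and a lower
triangular one. -/
theorem exists_upper_mul_lower {W J : Matrix n n R} (hW : ∀ i j, j < i → W i j = 0)
    (hW1 : ∀ i, W i i = 1) (hWJ : ∀ i j, i < j → (W * J) i j = 0) {d : n → Rˣ}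
    (hd : ∀ i, (W * J) i i = d i) (e : n → Rˣ) :
    ∃ V D : (Matrix n n R)ˣ, J = V.val * D.val ∧
      (∀ i j, j < i → V.val i j = 0) ∧ (∀ i j, j < i → V⁻¹.val i j = 0) ∧
      (∀ i j, i < j → D.val i j = 0) ∧ (∀ i j, i < j → D⁻¹.val i j = 0) ∧
      (∀ i, V.val i i = e i) ∧ ∀ i, D.val i i = ((e i)⁻¹ * d i : Rˣ) := by
  obtain ⟨U, hU, hU'⟩ := exists_upper_unit hW fun i => by rw [hW1]; exact isUnit_one
  let E : Matrix n n R := Matrix.diagonal fun i => (e i : R)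
  let E' : Matrix n n R := Matrix.diagonal fun i => ((e i)⁻¹ : Rˣ)
  have hE : E * E' = 1 := by simp [E, E', Matrix.diagonal_mul_diagonal]
  have hUd : ∀ i, U⁻¹.val i i = 1 := fun i => by
    have := upper_mul_diag hU' (hU ▸ hW) i
    rw [U.inv_mul, Matrix.one_apply_eq, hU, hW1, mul_one] at this
    exact this.symm
  have hVd : ∀ i, (U⁻¹.val * E) i i = e i := fun i => by
    rw [Matrix.mul_diagonal, hUd, one_mul]
  have hDd : ∀ i, (E' * (W * J)) i i = ((e i)⁻¹ * d i : Rˣ) := fun i => by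
    rw [Matrix.diagonal_mul, hd, Units.val_mul]
  -- The factors are W⁻¹E and E⁻¹(WJ), with `E` the diagonal matrix of the chosen units.
  obtain ⟨V, hV, hV'⟩ := exists_upper_unit (A := U⁻¹.val * E)
    (fun i j h => by rw [Matrix.mul_diagonal, hU' i j h, zero_mul])
    (fun i => hVd i ▸ Units.isUnit _)
  obtain ⟨D, hD, hD'⟩ := exists_lower_unit (A := E' * (W * J))
    (fun i j h => by rw [Matrix.diagonal_mul, hWJ i j h, mul_zero])
    (fun i => hDd i ▸ Units.isUnit _)
  refine ⟨V, D, ?_, fun i j h => ?_, hV', fun i j h => ?_, hD', fun i => hV ▸ hVd i,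
    fun i => hD ▸ hDd i⟩
  · rw [hV, hD, Matrix.mul_assoc, ← Matrix.mul_assoc E, hE, Matrix.one_mul, ← Matrix.mul_assoc,
      ← hU, U.inv_mul, Matrix.one_mul]
  · rw [hV, Matrix.mul_diagonal, hU' i j h, zero_mul]
  · rw [hD, Matrix.diagonal_mul, hWJ i j h, mul_zero]

/-- The mirror image of `exists_upper_mul_lower`. -/
theorem exists_lower_mul_upper {W J : Matrix n n R} (hW : ∀ i j, i < j → W i j = 0)
    (hW1 : ∀ i, W i i = 1) (hWJ : ∀ i j, j < i → (W * J) i j = 0) {d : n → Rˣ}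
    (hd : ∀ i, (W * J) i i = d i) (e : n → Rˣ) :
    ∃ V D : (Matrix n n R)ˣ, J = V.val * D.val ∧
      (∀ i j, i < j → V.val i j = 0) ∧ (∀ i j, i < j → V⁻¹.val i j = 0) ∧
      (∀ i j, j < i → D.val i j = 0) ∧ (∀ i j, j < i → D⁻¹.val i j = 0) ∧
      (∀ i, V.val i i = e i) ∧ ∀ i, D.val i i = ((e i)⁻¹ * d i : Rˣ) := by
  obtain ⟨V, D, h⟩ := exists_upper_mul_lower (n := nᵒᵈ) hW hW1 hWJ hd e
  exact ⟨⟨V.val, V⁻¹.val, V.mul_inv, V.inv_mul⟩, ⟨D.val, D⁻¹.val, D.mul_inv, D.inv_mul⟩, h⟩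

end Factorization

/-! ### Recursion for the diagonal units. -/

/-- The equations are solved alternately: `a k` gives `b (k + 1)` through `d k`, which gives `a (k +
1)` through `c (k + 1)`. In the application `c` holds the diagonals of the products of equal sign
and `d` the pivots of J. -/
theorem exists_alternating_left {G : Type*} [Group G] (c d : ℕ → G) (hc : c 0 = 1) :
    ∃ a b : ℕ → G, a 0 = 1 ∧ b 0 = 1 ∧ (∀ k, b k * a k = c k) ∧
      ∀ k, b (k + 1) * a k = d k := by
  let a : ℕ → G := fun k => Nat.rec 1 (fun k x => (d k * x⁻¹)⁻¹ * c (k + 1)) k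
  have ha : ∀ k, a (k + 1) = (d k * (a k)⁻¹)⁻¹ * c (k + 1) := fun _ => rfl
  have ha0 : a 0 = 1 := rfl
  refine ⟨a, fun k => c k * (a k)⁻¹, ha0, by simp [ha0, hc], fun k => by simp, fun k => ?_⟩
  change c (k + 1) * (a (k + 1))⁻¹ * a k = d k
  rw [ha]
  group

theorem exists_alternating_right {G : Type*} [Group G] (c d : ℕ → G) (hc : c 0 = 1) :
    ∃ a b : ℕ → G, a 0 = 1 ∧ b 0 = 1 ∧ (∀ k, a k * b k = c k) ∧
      ∀ k, a k * b (k + 1) = d k := by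
  let a : ℕ → G := fun k => Nat.rec 1 (fun k x => c (k + 1) * (x⁻¹ * d k)⁻¹) k
  have ha : ∀ k, a (k + 1) = c (k + 1) * ((a k)⁻¹ * d k)⁻¹ := fun _ => rfl
  have ha0 : a 0 = 1 := rfl
  refine ⟨a, fun k => (a k)⁻¹ * c k, ha0, by simp [ha0, hc], fun k => by simp, fun k => ?_⟩
  change a k * ((a (k + 1))⁻¹ * c (k + 1)) = d k
  rw [ha]
  group

/-! ### Existence of a zero-curvature partner. -/

section Existence

variable {n : ℕ} {R : Type*} [Ring R]

/-- Any factorization J = VD into upper times lower gives L̃^{+(2)} = V and L̃^{-(1)} = D, and (ZC)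
then forces L̃^{+(1)} = V⁻¹L^{+(1)}L^{+(2)} and L̃^{-(2)} = L^{-(1)}L^{-(2)}D⁻¹, which are
automatically triangular. Only the compatibility of the four diagonals has to be arranged. -/
theorem ForwardDomain.exists_zeroCurvature {X : LPair n R × LPair n R} (hX : ForwardDomain X) :
    ∃ Y : LPair n R × LPair n R, Y.1.IsLOperator ∧ Y.2.IsLOperator ∧ ZeroCurvature X Y := by
  obtain ⟨h₁, h₂, hJ⟩ := hX
  obtain ⟨u₁, U₁, C₁, h₁⟩ := h₁.exists_hasUnits
  obtain ⟨u₂, U₂, C₂, h₂⟩ := h₂.exists_hasUnits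
  obtain ⟨W, hW1, hW, hWJ, hd⟩ := exists_elimination (X.1.minus * X.2.plus) Finset.Ioi Finset.Ici
    (by simp) Ici_eq_insert_Ioi fun k => (hJ k).1
  choose d hd' using fun k => (hJ k).2
  -- The sequences `a` and `b` become the diagonal units of L̃^{(1)} and L̃^{(2)}. The same `c`
  -- serves both signs, shifted by one for the plus matrices. Pivots exist only for `k < n`; beyond
  -- that the value 1 is a harmless filler.
  obtain ⟨a, b, ha, hb, hc, hbd⟩ := exists_alternating_left (fun k => u₁ k * u₂ k)
    (fun k => if h : k < n then d ⟨k, h⟩ else 1) (by simp [h₁.zero, h₂.zero])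
  obtain ⟨V, D, hVD, hV, hV', hD, hD', hVd, hDd⟩ := exists_upper_mul_lower (d := d)
    (fun i j h => hW i j (by simpa using h)) hW1 (fun i j h => hWJ i j (by simpa using h))
    (fun i => by rw [hd, hd']) (fun i : Fin n => b (i + 1))
  have hDd' : ∀ i : Fin n, D.val i i = a i := fun i => by
    have := hbd i
    rw [dif_pos i.2] at this
    rw [hDd, ← this, inv_mul_cancel_left]
  have hP : ∀ i j, j < i → (X.1.plus * X.2.plus) i j = 0 :=
    upper_mul (h₁.plus ▸ h₁.upper) (h₂.plus ▸ h₂.upper)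
  have hN : ∀ i j, i < j → (X.1.minus * X.2.minus) i j = 0 :=
    lower_mul (h₁.minus ▸ h₁.lower) (h₂.minus ▸ h₂.lower)
  refine ⟨(⟨V⁻¹.val * (X.1.plus * X.2.plus), D.val⟩, ⟨V.val, X.1.minus * X.2.minus * D⁻¹.val⟩),
    LPair.isLOperator_of_units (upper_mul hV' hP) hD a ha (fun i => ?_) hDd',
    LPair.isLOperator_of_units hV (lower_mul hN hD') b hb hVd (fun i => ?_), ?_, hVD, ?_⟩
  · refine (upper_mul_diag hV' hP i).trans ?_
    rw [upper_inv_diag hV hV' (hVd i),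
      upper_mul_diag (h₁.plus ▸ h₁.upper) (h₂.plus ▸ h₂.upper), ← h₁.plus, ← h₂.plus,
      h₁.upper_diag, h₂.upper_diag, ← Units.val_mul, ← Units.val_mul, ← hc, inv_mul_cancel_left]
  · refine (lower_mul_diag hN hD' i).trans ?_
    rw [lower_inv_diag hD hD' (hDd' i),
      lower_mul_diag (h₁.minus ▸ h₁.lower) (h₂.minus ▸ h₂.lower), ← h₁.minus, ← h₂.minus,
      h₁.lower_diag, h₂.lower_diag, ← Units.val_mul, ← Units.val_mul, ← hc, mul_inv_cancel_right]
  · exact (Units.mul_inv_cancel_left V _).symm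
  · exact (Units.inv_mul_cancel_right _ D).symm

theorem BackwardDomain.exists_zeroCurvature {Y : LPair n R × LPair n R} (hY : BackwardDomain Y) :
    ∃ X : LPair n R × LPair n R, X.1.IsLOperator ∧ X.2.IsLOperator ∧ ZeroCurvature X Y := by
  obtain ⟨h₁, h₂, hJ⟩ := hY
  obtain ⟨v₁, V₁, D₁, h₁⟩ := h₁.exists_hasUnits
  obtain ⟨v₂, V₂, D₂, h₂⟩ := h₂.exists_hasUnits
  obtain ⟨W, hW1, hW, hWJ, hd⟩ := exists_elimination (Y.2.plus * Y.1.minus) Finset.Iio Finset.Iic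
    (by simp) Iic_eq_insert_Iio fun k => (hJ k).1
  choose d hd' using fun k => (hJ k).2
  -- Now J̃ is lower times upper, so the pivot equation is `a k * b (k + 1) = d k`: the index shift
  -- sits on the right factor L^{+(2)}.
  obtain ⟨a, b, ha, hb, hc, hbd⟩ := exists_alternating_right (fun k => v₂ k * v₁ k)
    (fun k => if h : k < n then d ⟨k, h⟩ else 1) (by simp [h₁.zero, h₂.zero])
  obtain ⟨C, U, hCU, hC, hC', hU, hU', hCd, hUd⟩ := exists_lower_mul_upper (d := d)
    (fun i j h => hW i j (by simpa using h)) hW1 (fun i j h => hWJ i j (by simpa using h))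
    (fun i => by rw [hd, hd']) (fun i : Fin n => a i)
  have hUd' : ∀ i : Fin n, U.val i i = b (i + 1) := fun i => by
    have := hbd i
    rw [dif_pos i.2] at this
    rw [hUd, ← this, inv_mul_cancel_left]
  have hP : ∀ i j, j < i → (Y.2.plus * Y.1.plus) i j = 0 :=
    upper_mul (h₂.plus ▸ h₂.upper) (h₁.plus ▸ h₁.upper)
  have hN : ∀ i j, i < j → (Y.2.minus * Y.1.minus) i j = 0 :=
    lower_mul (h₂.minus ▸ h₂.lower) (h₁.minus ▸ h₁.lower)
  refine ⟨(⟨Y.2.plus * Y.1.plus * U⁻¹.val, C.val⟩, ⟨U.val, C⁻¹.val * (Y.2.minus * Y.1.minus)⟩),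
    LPair.isLOperator_of_units (upper_mul hP hU') hC a ha (fun i => ?_) hCd,
    LPair.isLOperator_of_units hU (lower_mul hC' hN) b hb hUd' (fun i => ?_), ?_, hCU.symm, ?_⟩
  · refine (upper_mul_diag hP hU' i).trans ?_
    rw [upper_inv_diag hU hU' (hUd' i),
      upper_mul_diag (h₂.plus ▸ h₂.upper) (h₁.plus ▸ h₁.upper), ← h₁.plus, ← h₂.plus,
      h₁.upper_diag, h₂.upper_diag, ← Units.val_mul, ← Units.val_mul, ← hc, mul_inv_cancel_right]
  · refine (lower_mul_diag hC' hN i).trans ?_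
    rw [lower_inv_diag hC hC' (hCd i),
      lower_mul_diag (h₂.minus ▸ h₂.lower) (h₁.minus ▸ h₁.lower), ← h₁.minus, ← h₂.minus,
      h₁.lower_diag, h₂.lower_diag, ← Units.val_mul, ← Units.val_mul, ← hc, inv_mul_cancel_left]
  · exact Units.inv_mul_cancel_right _ U
  · exact Units.mul_inv_cancel_left C _

end Existence

theorem theorem2p6 {R : Type*} [Ring R] (n : ℕ) :
    (∀ Y : LPair n R × LPair n R, BackwardDomain Y →
      BackwardDefined Y ∧ ForwardDomain (backwardMap Y) ∧
      ZeroCurvature (backwardMap Y) Y ∧ forwardMap (backwardMap Y) = Y) ∧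
    (∀ X : LPair n R × LPair n R, ForwardDomain X →
      ForwardDefined X ∧ BackwardDomain (forwardMap X) ∧
      ZeroCurvature X (forwardMap X) ∧ backwardMap (forwardMap X) = X) := by
  refine ⟨fun Y hY => ?_, fun X hX => ?_⟩
  -- The partner `X` of `Y` is identified with `backwardMap Y` by `ZeroCurvature.backward`, after
  -- which `ZeroCurvature.forward` for the same pair gives the way back.
  · obtain ⟨X, h₁, h₂, h⟩ := hY.exists_zeroCurvature
    obtain ⟨f₁, -, f₃⟩ := h.forward h₁ h₂ hY.1 hY.2.1
    obtain ⟨-, b₂, rfl⟩ := h.backward h₁ h₂ hY.1 hY.2.1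
    exact ⟨b₂, f₁, h, f₃⟩
  · obtain ⟨Y, h₁, h₂, h⟩ := hX.exists_zeroCurvature
    obtain ⟨b₁, -, b₃⟩ := h.backward hX.1 hX.2.1 h₁ h₂
    obtain ⟨-, f₂, rfl⟩ := h.forward hX.1 hX.2.1 h₁ h₂
    exact ⟨f₂, b₁, h, b₃⟩
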